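/- Let $\mathbb{F}_q$ be a finite field. A \emph{linear circuit} over $\mathbb{F}_q$ is a finite directed acyclic graph whose sources include the inputs and whose other nodes are weighted addition gates of unbounded fan-in: a gate with incoming values $x_1,\dots,x_s$ computes $\sum_i c_i x_i$ for fixed constants $c_i\in\mathbb{F}_q$. Its outputs are designated distinct gates. Its size is the number of wires. It is a depth-$d$ circuit if every path from an input to an output has at most $d$ wires. For $f:\mathbb{N}\to\mathbb{N}$ let $f^*(n)=\min\{i : f^{(i)}(n)\le 1\}$, where $f^{(i)}$ is the $i$-fold composition of $f$. Put $\lambda_1(n)=\lfloor\sqrt n\rfloor$, $\lambda_2(n)=\lceil\log_2 n\rceil$ and $\lambda_d=\lambda_{d-2}^*$ for $d\ge 3$. For $n\ge 1$ let $\alpha(n)$ be the least positive even integer $d$ with $\lambda_d(n)\le 6$. There is a constant $K$ depending only on $q$ (and not on $d$ or $n$) such that the following hold. 1. For all integers $d\ge 1$ and $n\ge 1$ there is a linear code $C:\mathbb{F}_q^n\to\mathbb{F}_q^{32n}$ with minimum distance at least $4n$ that is computed by a depth-$d$ linear circuit; if moreover $d\ge 3$ and $n\ge 2$, then $C$ and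 the circuit can be chosen so that the circuit has size at most $K\,\lambda_d(n)\,n$. 2. For every integer $n\ge 1$ there is a linear code $C:\mathbb{F}_q^n\to\mathbb{F}_q^{32n}$ with minimum distance at least $4n$ that is computed by a linear circuit of depth at most $\alpha(n)$ and size at most $K\,n$. -/

import Mathlib

/-- `f^*(n) = min {i : f^{(i)}(n) ≤ 1}`, where `f^{(i)}` is the `i`-fold composition of `f`. -/
noncomputable def iterStar (f : ℕ → ℕ) (n : ℕ) : ℕ :=
  sInf {i : ℕ | f^[i] n ≤ 1}

/-- The slowly growing functions `λ_1(n) = ⌊√n⌋`, `λ_2(n) = ⌈log₂ n⌉`, `λ_d = λ_{d-2}^*` for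
`d ≥ 3`. (The index `0` is not used; a value is given only to make the function total.) -/
noncomputable def lambdaFn : ℕ → ℕ → ℕ
  | 0 => fun n => n
  | 1 => Nat.sqrt
  | 2 => Nat.clog 2
  | (d + 3) => iterStar (lambdaFn (d + 1))

/-- The inverse Ackermann function: the least positive even `d` with `λ_d(n) ≤ 6`. -/
noncomputable def invAckermann (n : ℕ) : ℕ :=
  sInf {d : ℕ | 0 < d ∧ Even d ∧ lambdaFn d n ≤ 6}

/-- A linear circuit over `F` with `n` inputs and `m` outputs, made of weighted addition gates of
unbounded fan-in. A node is an input (`Sum.inl i`) or a gate (`Sum.inr g`); wires run from nodes to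
gates. The gates are numbered in a topological order, so the circuit is acyclic. The outputs are
`m` distinct gates. -/
structure LinearCircuit (F : Type*) (n m : ℕ) where
  /-- number of gates -/
  gates : ℕ
  /-- the wires -/
  wires : Finset ((Fin n ⊕ Fin gates) × Fin gates)
  /-- the constant on each wire (the values off `wires` play no role) -/
  coeff : (Fin n ⊕ Fin gates) → Fin gates → F
  /-- a wire between two gates goes from a smaller to a larger gate -/
  acyclic : ∀ h g : Fin gates, (Sum.inr h, g) ∈ wires → h < g
  /-- the output gates -/
  output : Fin m ↪ Fin gates

namespace LinearCircuit

variable {F : Type*} {n m : ℕ}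

/-- The size of a circuit is its number of wires. -/
def size (c : LinearCircuit F n m) : ℕ := c.wires.card

/-- The value at gate `g` on input `x`: the linear combination, with the constants on the wires,
of the values at the nodes that are wired to `g`. By acyclicity, only gates before `g` are wired
to `g`. -/
def gateValue [Semiring F] (c : LinearCircuit F n m) (x : Fin n → F) (g : Fin c.gates) : F :=
  (∑ i : Fin n, if (Sum.inl i, g) ∈ c.wires then c.coeff (Sum.inl i) g * x i else 0) +
    ∑ h : {h : Fin c.gates // h < g},
      if (Sum.inr h.1, g) ∈ c.wires then c.coeff (Sum.inr h.1) g * c.gateValue x h.1 else 0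
termination_by g.val
decreasing_by exact h.2

/-- The output vector on input `x`. -/
def eval [Semiring F] (c : LinearCircuit F n m) (x : Fin n → F) : Fin m → F :=
  fun j => c.gateValue x (c.output j)

/-- `c.PathFromInput v k`: there is a directed path with `k` wires from some input to node `v`. -/
inductive PathFromInput (c : LinearCircuit F n m) : (Fin n ⊕ Fin c.gates) → ℕ → Prop
  | input (i : Fin n) : PathFromInput c (Sum.inl i) 0
  | wire {v : Fin n ⊕ Fin c.gates} {g : Fin c.gates} {k : ℕ} :
      PathFromInput c v k → (v, g) ∈ c.wires → PathFromInput c (Sum.inr g) (k + 1)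

/-- The circuit has depth at most `d`: every path from an input to an output has length at most
`d`. -/
def DepthLE (c : LinearCircuit F n m) (d : ℕ) : Prop :=
  ∀ (j : Fin m) (k : ℕ), c.PathFromInput (Sum.inr (c.output j)) k → k ≤ d

/-- The circuit computes the map `C`. -/
def Computes [Semiring F] (c : LinearCircuit F n m) (C : (Fin n → F) →ₗ[F] (Fin m → F)) : Prop :=
  ∀ x : Fin n → F, c.eval x = C x

end LinearCircuit

/-- The code with encoding map `C` has minimum (Hamming) distance at least `D`. -/
def MinDistGE {F : Type*} [Semiring F] [DecidableEq F] {n m : ℕ}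
    (C : (Fin n → F) →ₗ[F] (Fin m → F)) (D : ℕ) : Prop :=
  ∀ x y : Fin n → F, x ≠ y → D ≤ hammingDist (C x) (C y)

/-! The carrier of the proof is the sampler (`HasSampler`): a circuit with a sparse random row on
its nodes which, on every input of a class, takes each value with probability at most `9 / (8 q)`.
Samplers and codes convert into each other. Fixing `8 k` independent rows by an exponential-moment
and union bound over fewer than `q ^ k` inputs adds one layer and gives a code; a sample of `O(q)`
outputs of a code is a sampler of the same depth. Samplers for two classes combine by adding
independent rows.

Inputs are classified by weight. Those of weight at least `n / Z` are sampled directly with `O(q Z)`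
positions. Lighter ones are first condensed: a random bipartite graph of left degree `9` expands
small sets by more than half its degree, so unique neighbours give a map with at most `9 n` wires
onto `n / g` gates that does not lower small weights.

For weights between `n / (4096 X ^ 4)` and `n / (4096 Y ^ 4)`, with `Y = f X`, one condenses to `m =
n / (8 Y ^ 2)` gates. If `f` is the function `λ` reached so far, a code on these gates costs `O(m
Y)`, which is `O(n)` with room to spare, so the constant does not grow with the depth. Iterating `X
↦ f X` down to `1` takes `f^*(X)` steps. Thus one star costs two layers, condensing and encoding;
the recursion starts from the square root and the logarithm. -/

open Finset

universe u

/-! ### Circuits with levels, and their translation to numbered gates -/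

/-- A circuit of weighted addition gates over the inputs `ι` with an arbitrary finite type of gates.
Acyclicity is witnessed by a level function, and the linear map computed at all nodes is part of
the data. -/
structure Circ (F : Type*) [Field F] (ι : Type) [Fintype ι] where
  G : Type
  fintypeG : Fintype G
  level : G → ℕ
  w : G → ι ⊕ G → F
  val : (ι → F) →ₗ[F] (ι ⊕ G → F)
  level_pos : ∀ g, 1 ≤ level g
  level_lt : ∀ g h, w g (Sum.inr h) ≠ 0 → level h < level g
  val_inl : ∀ x i, val x (Sum.inl i) = x i
  val_inr : ∀ x g, val x (Sum.inr g) = ∑ v, w g v * val x v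

namespace Circ

attribute [instance] Circ.fintypeG

variable {F : Type*} [Field F] [DecidableEq F] {ι κ : Type} [Fintype ι] [Fintype κ]

/-- The number of wires with a nonzero constant. -/
def size (c : Circ F ι) : ℕ := ∑ g, hammingNorm (c.w g)

/-- The circuit without gates. -/
def empty (F : Type*) [Field F] (ι : Type) [Fintype ι] : Circ F ι where
  G := Empty
  fintypeG := inferInstance
  level := fun _ => 1
  w := fun g => g.elim
  val := LinearMap.pi (Sum.elim (fun i => LinearMap.proj i) (fun g => g.elim))
  level_pos := fun _ => le_rfl
  level_lt := fun g => g.elim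
  val_inl := fun x i => by simp
  val_inr := fun x g => g.elim

/-- Feed the values of a layer of gates into the inputs of a circuit. -/
def precomp (A : Matrix κ ι F) (c : Circ F κ) : Circ F ι where
  G := κ ⊕ c.G
  fintypeG := inferInstance
  level := Sum.elim (fun _ => 1) (fun g => c.level g + 1)
  w := Sum.elim (fun k => Sum.elim (A k) 0) (fun g => Sum.elim 0 (c.w g))
  val := LinearMap.pi (Sum.elim (fun i => LinearMap.proj i)
    (fun v => LinearMap.proj v ∘ₗ c.val ∘ₗ A.mulVecLin))
  level_pos := by rintro (k | g) <;> simp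
  level_lt := by
    rintro (k | g) (k' | h) hw
    · simp at hw
    · simp at hw
    · simpa using Nat.pos_of_ne_zero (Nat.one_le_iff_ne_zero.1 (c.level_pos g))
    · simpa using c.level_lt g h (by simpa using hw)
  val_inl := fun x i => by simp
  val_inr := by
    rintro x (k | g)
    · simp [c.val_inl, Matrix.mulVec, dotProduct]
    · simpa using c.val_inr (A.mulVec x) g

/-- Two circuits side by side on the same inputs. -/
def union (c₁ c₂ : Circ F ι) : Circ F ι where
  G := c₁.G ⊕ c₂.G
  fintypeG := inferInstance
  level := Sum.elim c₁.level c₂.level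
  w := Sum.elim
    (fun g => Sum.elim (fun i => c₁.w g (Sum.inl i)) (Sum.elim (fun h => c₁.w g (Sum.inr h)) 0))
    (fun g => Sum.elim (fun i => c₂.w g (Sum.inl i)) (Sum.elim 0 (fun h => c₂.w g (Sum.inr h))))
  val := LinearMap.pi (Sum.elim (fun i => LinearMap.proj i)
    (Sum.elim (fun g => LinearMap.proj (Sum.inr g) ∘ₗ c₁.val)
      (fun g => LinearMap.proj (Sum.inr g) ∘ₗ c₂.val)))
  level_pos := by rintro (g | g) <;> simp [level_pos]
  level_lt := by
    rintro (g | g) (h | h) hw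
    · simpa using c₁.level_lt g h (by simpa using hw)
    · simp at hw
    · simp at hw
    · simpa using c₂.level_lt g h (by simpa using hw)
  val_inl := fun x i => by simp
  val_inr := by
    rintro x (g | g)
    · simpa [c₁.val_inl] using c₁.val_inr x g
    · simpa [c₂.val_inl] using c₂.val_inr x g

/-- Add a layer of gates on top of a circuit whose levels are at most `d`. -/
def append (c : Circ F ι) (d : ℕ) (hd : ∀ g, c.level g ≤ d) (B : κ → ι ⊕ c.G → F) :
    Circ F ι where
  G := c.G ⊕ κ
  fintypeG := inferInstance
  level := Sum.elim c.level (fun _ => d + 1)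
  w := Sum.elim
    (fun g => Sum.elim (fun i => c.w g (Sum.inl i)) (Sum.elim (fun h => c.w g (Sum.inr h)) 0))
    (fun k => Sum.elim (fun i => B k (Sum.inl i)) (Sum.elim (fun h => B k (Sum.inr h)) 0))
  val := LinearMap.pi (Sum.elim (fun i => LinearMap.proj i)
    (Sum.elim (fun g => LinearMap.proj (Sum.inr g) ∘ₗ c.val)
      (fun k => ∑ v, B k v • (LinearMap.proj v ∘ₗ c.val))))
  level_pos := by rintro (g | g) <;> simp [level_pos]
  level_lt := by
    rintro (g | g) (h | h) hw
    · simpa using c.level_lt g h (by simpa using hw)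
    · simp at hw
    · simpa [Nat.lt_succ_iff] using hd h
    · simp at hw
  val_inl := fun x i => by simp
  val_inr := by
    rintro x (g | g)
    · simpa [c.val_inl] using c.val_inr x g
    · simp [c.val_inl]

theorem hammingNorm_sumElim (f : ι → F) (g : κ → F) :
    hammingNorm (Sum.elim f g : ι ⊕ κ → F) = hammingNorm f + hammingNorm g := by
  simp only [hammingNorm, Finset.card_filter, Fintype.sum_sum_type]
  rfl

theorem hammingNorm_split (f : ι ⊕ κ → F) :
    hammingNorm f = hammingNorm (fun i => f (Sum.inl i)) + hammingNorm (fun k => f (Sum.inr k)) := by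
  rw [← hammingNorm_sumElim]
  congr 1
  ext (i | k) <;> rfl

theorem size_empty : (empty F ι).size = 0 := by
  unfold size
  exact Fintype.sum_empty (ι := Empty) _

theorem size_precomp (A : Matrix κ ι F) (c : Circ F κ) :
    (precomp A c).size = ∑ k, hammingNorm (A k) + c.size := by
  unfold size precomp
  simp [Fintype.sum_sum_type, hammingNorm_sumElim]

theorem size_union (c₁ c₂ : Circ F ι) : (union c₁ c₂).size = c₁.size + c₂.size := by
  unfold size union
  simp [Fintype.sum_sum_type, hammingNorm_sumElim, hammingNorm_split (c₁.w _),
    hammingNorm_split (c₂.w _)]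

theorem size_append (c : Circ F ι) (d : ℕ) (hd : ∀ g, c.level g ≤ d) (B : κ → ι ⊕ c.G → F) :
    (append c d hd B).size = c.size + ∑ k, hammingNorm (B k) := by
  unfold size append
  simp [Fintype.sum_sum_type, hammingNorm_sumElim, hammingNorm_split (c.w _),
    hammingNorm_split (B _)]

omit [DecidableEq F] in
theorem append_val (c : Circ F ι) (d : ℕ) (hd : ∀ g, c.level g ≤ d) (B : κ → ι ⊕ c.G → F)
    (x : ι → F) (k : κ) :
    (append c d hd B).val x (Sum.inr (Sum.inr k)) = B k ⬝ᵥ c.val x := by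
  change (∑ v, B k v • (LinearMap.proj v ∘ₗ c.val)) x = _
  simp [dotProduct]

omit [DecidableEq F] in
/-- A numbering of the gates along which the level is monotone. -/
theorem exists_monotone_numbering (c : Circ F ι) :
    ∃ e : Fin (Fintype.card c.G) ≃ c.G, Monotone (c.level ∘ e) := by
  let e₀ := (Fintype.equivFin c.G).symm
  exact ⟨(Tuple.sort (c.level ∘ e₀)).trans e₀, Tuple.monotone_sort (c.level ∘ e₀)⟩

/-- Numbering the gates by increasing level makes the wires acyclic. Levels start at `1` and
increase along wires, so a path from an input is no longer than the level of its end. -/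
theorem exists_linearCircuit {n M d : ℕ} (c : Circ F (Fin n)) (hd : ∀ g, c.level g ≤ d)
    (out : Fin M → c.G) (hout : Function.Injective out) :
    ∃ (C : (Fin n → F) →ₗ[F] (Fin M → F)) (c' : LinearCircuit F n M),
      (∀ x, C x = fun j => c.val x (Sum.inr (out j))) ∧ c'.Computes C ∧ c'.DepthLE d ∧
        c'.size = c.size := by
  classical
  obtain ⟨e, he⟩ := c.exists_monotone_numbering
  have hlt : ∀ a b, c.level (e a) < c.level (e b) → a < b := fun a b h => by
    by_contra! hba
    exact absurd (he hba) (not_le.2 h)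
  let node : Fin n ⊕ Fin (Fintype.card c.G) ≃ Fin n ⊕ c.G := Equiv.sumCongr (Equiv.refl _) e
  let c' : LinearCircuit F n M :=
    { gates := Fintype.card c.G
      wires := univ.filter fun p => c.w (e p.2) (node p.1) ≠ 0
      coeff := fun v g => c.w (e g) (node v)
      acyclic := fun h g hw => hlt _ _ (c.level_lt _ _ (by simpa [node] using hw))
      output := ⟨fun j => e.symm (out j), fun a b h => hout (e.symm.injective h)⟩ }
  have hval : ∀ x g, c'.gateValue x g = c.val x (Sum.inr (e g)) := by
    intro x g
    induction g using WellFoundedLT.induction with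
    | ind g ih =>
      rw [LinearCircuit.gateValue, c.val_inr, Fintype.sum_sum_type]
      congr 1
      · refine Finset.sum_congr rfl fun i _ => ?_
        by_cases h : c.w (e g) (Sum.inl i) = 0 <;> simp [c', node, c.val_inl, h]
      · rw [← e.sum_comp]
        have : ∀ h : {h // h < g}, (if (Sum.inr h.1, g) ∈ c'.wires then
            c'.coeff (Sum.inr h.1) g * c'.gateValue x h.1 else 0) =
            c.w (e g) (Sum.inr (e h.1)) * c.val x (Sum.inr (e h.1)) := by
          intro h
          rw [ih h.1 h.2]
          by_cases h0 : c.w (e g) (Sum.inr (e h.1)) = 0 <;> simp [c', node, h0]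
        rw [Finset.sum_congr rfl fun h _ => this h]
        rw [← Finset.sum_subtype (univ.filter fun h : Fin c'.gates => h < g)
          (p := fun h => h < g) (by simp)
          (fun h => c.w (e g) (Sum.inr (e h)) * c.val x (Sum.inr (e h)))]
        refine Finset.sum_subset (Finset.subset_univ _) fun h _ hh => ?_
        have : c.w (e g) (Sum.inr (e h)) = 0 := by
          by_contra h0
          exact hh (by simpa using hlt _ _ (c.level_lt _ _ h0))
        simp [this]
  refine ⟨LinearMap.pi fun j => LinearMap.proj (Sum.inr (out j)) ∘ₗ c.val, c', fun x => rfl,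
    fun x => ?_, ?_, ?_⟩
  · funext j
    refine (hval x _).trans ?_
    change c.val x (Sum.inr (e (e.symm (out j)))) = c.val x (Sum.inr (out j))
    rw [e.apply_symm_apply]
  · have key : ∀ v k, c'.PathFromInput v k →
        k ≤ Sum.elim (fun _ => 0) (fun g => c.level (e g)) v := by
      intro v k hp
      induction hp with
      | input i => simp
      | @wire v g k _ hw ih =>
        have hw' : c.w (e g) (node v) ≠ 0 := by simpa [c'] using hw
        rcases v with i | h
        · have := c.level_pos (e g)
          simp at ih ⊢
          omega
        · have := c.level_lt (e g) (e h) (by simpa [node] using hw')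
          simp at ih ⊢
          omega
    intro j k hp
    exact (key _ _ hp).trans (by simpa [c'] using hd _)
  · have : c'.size = ∑ g, ∑ v, if c.w (e g) (node v) ≠ 0 then 1 else 0 := by
      rw [LinearCircuit.size, Finset.card_filter, Fintype.sum_prod_type, Finset.sum_comm]
    rw [this, size, ← e.sum_comp]
    refine Finset.sum_congr rfl fun g _ => ?_
    rw [hammingNorm, Finset.card_filter, ← node.sum_comp]

end Circ

/-! ### Fixing random rows -/

/-- If for each of fewer than `q ^ k` objects at most a fraction `9 / (8 q)` of the rows is bad,
then some choice of `8 k` rows has at least `k` good rows for every object. -/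
theorem exists_rows_of_bad_fraction_le {R X J : Type*} [Fintype R] [Nonempty R] [Fintype J]
    {q k : ℕ} (hq : 2 ≤ q) (hJ : Fintype.card J = 8 * k) (good : R → X → Prop)
    [∀ r x, Decidable (good r x)] (𝒳 : Finset X)
    (hbad : ∀ x ∈ 𝒳, 8 * q * #{r | ¬ good r x} ≤ 9 * Fintype.card R) (hcard : #𝒳 < q ^ k) :
    ∃ r : J → R, ∀ x ∈ 𝒳, k ≤ #{j | good (r j) x} := by
  classical
  by_contra! hcon
  have hq0 : (2 : ℝ) ≤ q := by exact_mod_cast hq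
  have hR : (0 : ℝ) < Fintype.card R := by exact_mod_cast Fintype.card_pos
  -- A good row is weighted `u` and a bad one `1`. The mean is then at most `u + 9 u = 5 / (4 q)`,
  -- whose eighth power is at most `u / q`. Hence `8 k` rows beat a union bound over fewer than `q ^
  -- k` objects.
  set u : ℝ := 1 / (8 * q) with hu
  have hu0 : 0 < u := by positivity
  have hu1 : u ≤ 1 := by
    rw [hu, div_le_one (by positivity)]
    linarith
  have h1 : (Fintype.card R : ℝ) ^ (8 * k) * u ^ k ≤
      ∑ r : J → R, ∑ x ∈ 𝒳, ∏ j, (if good (r j) x then u else 1) := by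
    have : ∑ r : J → R, u ^ k = (Fintype.card R : ℝ) ^ (8 * k) * u ^ k := by
      simp [hJ]
    rw [← this]
    refine Finset.sum_le_sum fun r _ => ?_
    obtain ⟨x, hx, hlt⟩ := hcon r
    have h2 : ∏ j, (if good (r j) x then u else 1) = u ^ #{j | good (r j) x} := by
      rw [Finset.prod_ite]
      simp
    calc u ^ k ≤ u ^ #{j | good (r j) x} := pow_le_pow_of_le_one hu0.le hu1 hlt.le
      _ = _ := h2.symm
      _ ≤ _ := Finset.single_le_sum
        (f := fun x => ∏ j, (if good (r j) x then u else (1 : ℝ)))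
        (fun x _ => Finset.prod_nonneg fun j _ => by split_ifs <;> positivity) hx
  have h2 : ∀ x ∈ 𝒳, ∑ r : J → R, ∏ j, (if good (r j) x then u else 1) ≤
      (Fintype.card R : ℝ) ^ (8 * k) * (u ^ k / q ^ k) := by
    intro x hx
    rw [← Fintype.prod_sum (fun (_ : J) r => if good r x then u else (1 : ℝ))]
    rw [Finset.prod_const, Finset.card_univ, hJ]
    have h3 : ∑ r : R, (if good r x then u else (1 : ℝ)) ≤ Fintype.card R * (5 / (4 * q)) := by
      rw [Finset.sum_ite]
      simp only [Finset.sum_const, nsmul_eq_mul, mul_one]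
      have hb : (8 * q * #{r | ¬ good r x} : ℝ) ≤ 9 * Fintype.card R := by
        exact_mod_cast hbad x hx
      have hg : (#{r | good r x} : ℝ) ≤ Fintype.card R := by
        exact_mod_cast Finset.card_le_univ _
      have hb' : (#{r | ¬ good r x} : ℝ) ≤ 9 * Fintype.card R * u := by
        rw [hu, mul_one_div, le_div_iff₀ (by positivity)]
        linarith
      calc (#{r | good r x} : ℝ) * u + #{r | ¬ good r x}
          ≤ Fintype.card R * u + 9 * Fintype.card R * u := by gcongr
        _ = Fintype.card R * (5 / (4 * q)) := by rw [hu]; field_simp; norm_num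
    have h4 : ((5 : ℝ) / (4 * q)) ^ 8 ≤ u / q := by
      have h6 : (64 : ℝ) ≤ (q : ℝ) ^ 6 := by
        calc (64 : ℝ) = 2 ^ 6 := by norm_num
          _ ≤ _ := by gcongr
      rw [hu, div_div, div_pow, div_le_div_iff₀ (by positivity) (by positivity)]
      have : (0 : ℝ) < (q : ℝ) ^ 2 := by positivity
      nlinarith [mul_le_mul_of_nonneg_right h6 this.le]
    calc (∑ r : R, (if good r x then u else (1 : ℝ))) ^ (8 * k)
        ≤ (Fintype.card R * (5 / (4 * q))) ^ (8 * k) := by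
          refine pow_le_pow_left₀ (Finset.sum_nonneg fun r _ => ?_) h3 _
          split_ifs <;> positivity
      _ = (Fintype.card R : ℝ) ^ (8 * k) * ((5 / (4 * q)) ^ 8) ^ k := by
          rw [mul_pow, ← pow_mul]
      _ ≤ (Fintype.card R : ℝ) ^ (8 * k) * (u / q) ^ k := by gcongr
      _ = _ := by rw [div_pow]
  rw [Finset.sum_comm] at h1
  have h3 := h1.trans (Finset.sum_le_sum h2)
  rw [Finset.sum_const, nsmul_eq_mul] at h3
  have hc : (#𝒳 : ℝ) < (q : ℝ) ^ k := by exact_mod_cast hcard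
  have hpos : (0 : ℝ) < (Fintype.card R : ℝ) ^ (8 * k) * u ^ k := by positivity
  have hqk : (0 : ℝ) < (q : ℝ) ^ k := by positivity
  have : (#𝒳 : ℝ) * ((Fintype.card R : ℝ) ^ (8 * k) * (u ^ k / q ^ k)) <
      (q : ℝ) ^ k * ((Fintype.card R : ℝ) ^ (8 * k) * (u ^ k / q ^ k)) := by
    gcongr
  have h5 : (q : ℝ) ^ k * ((Fintype.card R : ℝ) ^ (8 * k) * (u ^ k / q ^ k)) =
      (Fintype.card R : ℝ) ^ (8 * k) * u ^ k := by
    field_simp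
  linarith

/-! ### Random weighted samples of positions -/

section Sampling

variable {F : Type*} [Field F] [Fintype F] [DecidableEq F] {V : Type*} [Fintype V]

/-- The number of samples of `T` weighted positions on which `y` evaluates to `s`. -/
def sampleCount (y : V → F) (T : ℕ) (s : F) : ℕ :=
  #{r : Fin T → V × F | ∑ l, (r l).2 * y (r l).1 = s}

theorem sum_sampleCount (y : V → F) (T : ℕ) :
    ∑ s, sampleCount y T s = (Fintype.card V * Fintype.card F) ^ T := by
  classical
  have := Finset.card_eq_sum_card_fiberwise (s := (univ : Finset (Fin T → V × F)))
    (t := (univ : Finset F)) (f := fun r => ∑ l, (r l).2 * y (r l).1) (fun _ _ => by simp)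
  unfold sampleCount
  rw [← this]
  simp

theorem sampleCount_succ (y : V → F) (T : ℕ) (s : F) :
    sampleCount y (T + 1) s = ∑ v, ∑ a, sampleCount y T (s - a * y v) := by
  unfold sampleCount
  simp only [Finset.card_filter]
  rw [← (Fin.consEquiv fun _ : Fin (T + 1) => V × F).sum_comp, Fintype.sum_prod_type,
    Fintype.sum_prod_type]
  refine Finset.sum_congr rfl fun v _ => Finset.sum_congr rfl fun a _ =>
    Finset.sum_congr rfl fun r _ => ?_
  simp only [Fin.consEquiv, Equiv.coe_fn_mk, Fin.sum_univ_succ, Fin.cons_zero, Fin.cons_succ]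
  congr 1
  rw [eq_sub_iff_add_eq, add_comm]

/-- Where `y v = 0`, the new coefficient is irrelevant. Elsewhere `a ↦ s - a * y v` is a bijection
of the field, so the counts add up to all samples of length `T`. -/
theorem sampleCount_succ_eq (y : V → F) (T : ℕ) (s : F) :
    sampleCount y (T + 1) s = #{v | y v = 0} * (Fintype.card F * sampleCount y T s) +
      hammingNorm y * (Fintype.card V * Fintype.card F) ^ T := by
  rw [sampleCount_succ, ← Finset.sum_filter_add_sum_filter_not univ (fun v => y v = 0)]
  congr 1
  · rw [Finset.sum_congr rfl (g := fun _ => Fintype.card F * sampleCount y T s), Finset.sum_const,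
      smul_eq_mul]
    intro v hv
    simp [(Finset.mem_filter.1 hv).2]
  · rw [Finset.sum_congr rfl (g := fun _ => (Fintype.card V * Fintype.card F) ^ T),
      Finset.sum_const, smul_eq_mul]
    · rfl
    intro v hv
    have hv0 : y v ≠ 0 := (Finset.mem_filter.1 hv).2
    rw [← sum_sampleCount y T]
    exact Fintype.sum_equiv ((Equiv.mulRight₀ (y v) hv0).trans (Equiv.subLeft s)) _ _
      fun a => by simp

/-- One sampled nonzero position makes the sum uniform. What exceeds `1 / q` is the probability that
all sampled positions vanish. -/
theorem sampleCount_le [Nonempty V] (y : V → F) (T : ℕ) (s : F) :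
    (sampleCount y T s : ℝ) ≤ (Fintype.card V * Fintype.card F : ℝ) ^ T *
      (1 / Fintype.card F + (#{v | y v = 0} / Fintype.card V : ℝ) ^ T) := by
  have hV : (0 : ℝ) < Fintype.card V := by exact_mod_cast Fintype.card_pos
  have hF : (0 : ℝ) < Fintype.card F := by exact_mod_cast Fintype.card_pos
  induction T with
  | zero =>
    have : sampleCount y 0 s ≤ 1 := by
      unfold sampleCount
      exact (Finset.card_le_univ _).trans (by simp)
    have h2 : (sampleCount y 0 s : ℝ) ≤ 1 := by exact_mod_cast this
    have : (0 : ℝ) < 1 / Fintype.card F := by positivity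
    simp only [pow_zero, one_mul]
    linarith
  | succ T ih =>
    have hw : (#{v | y v = 0} : ℝ) + hammingNorm y = Fintype.card V := by
      have := Finset.card_filter_add_card_filter_not (s := (univ : Finset V)) (fun v => y v = 0)
      exact_mod_cast this
    rw [sampleCount_succ_eq]
    push_cast
    set z : ℝ := (#{v | y v = 0} : ℝ)
    have hz : 0 ≤ z := Nat.cast_nonneg _
    calc z * (Fintype.card F * sampleCount y T s) +
          hammingNorm y * (Fintype.card V * Fintype.card F : ℝ) ^ T
        ≤ z * (Fintype.card F * ((Fintype.card V * Fintype.card F : ℝ) ^ T *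
            (1 / Fintype.card F + (z / Fintype.card V : ℝ) ^ T))) +
          hammingNorm y * (Fintype.card V * Fintype.card F : ℝ) ^ T := by gcongr
      _ = (Fintype.card V * Fintype.card F : ℝ) ^ (T + 1) *
            (1 / Fintype.card F + (z / Fintype.card V : ℝ) ^ (T + 1)) := by
          rw [eq_sub_of_add_eq' hw, pow_succ, pow_succ]
          field_simp
          ring

theorem sampleCount_mul_le [Nonempty V] (y : V → F) {Z : ℕ}
    (hy : Fintype.card V ≤ Z * hammingNorm y) (s : F) :
    8 * Fintype.card F * sampleCount y ((Fintype.card F + 3) * Z) s ≤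
      9 * (Fintype.card V * Fintype.card F) ^ ((Fintype.card F + 3) * Z) := by
  have hV : (0 : ℝ) < Fintype.card V := by exact_mod_cast Fintype.card_pos
  have hF : (0 : ℝ) < Fintype.card F := by exact_mod_cast Fintype.card_pos
  have hZ : (0 : ℝ) < Z := by
    rcases Nat.eq_zero_or_pos Z with rfl | h
    · have : 0 < Fintype.card V := Fintype.card_pos
      omega
    · exact_mod_cast h
  have hw : (#{v | y v = 0} : ℝ) + hammingNorm y = Fintype.card V := by
    have := Finset.card_filter_add_card_filter_not (s := (univ : Finset V)) (fun v => y v = 0)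
    exact_mod_cast this
  set q := Fintype.card F
  have hy' : (Fintype.card V : ℝ) ≤ Z * hammingNorm y := by exact_mod_cast hy
  have hρ : (#{v | y v = 0} / Fintype.card V : ℝ) ≤ Real.exp (-(1 / Z)) := by
    refine le_trans ?_ (Real.one_sub_le_exp_neg _)
    rw [eq_sub_of_add_eq hw, sub_div, div_self hV.ne']
    gcongr 1 - ?_
    rw [div_le_div_iff₀ hZ hV]
    linarith
  -- The `q` in the exponent `q + 3` beats `1 / q` and the `3` gives the `8`: `exp (-(q + 3)) ≤ 2 ^
  -- (-(q + 3)) ≤ 1 / (8 q)`. Added to `1 / q` this is `9 / (8 q)`.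
  have hρT : (#{v | y v = 0} / Fintype.card V : ℝ) ^ ((q + 3) * Z) ≤ 1 / (8 * q) := by
    calc (#{v | y v = 0} / Fintype.card V : ℝ) ^ ((q + 3) * Z)
        ≤ Real.exp (-(1 / Z)) ^ ((q + 3) * Z) := by gcongr
      _ = (Real.exp 1 ^ (q + 3))⁻¹ := by
          rw [← Real.exp_nat_mul, ← Real.exp_nat_mul, ← Real.exp_neg]
          congr 1
          push_cast
          field_simp
      _ ≤ ((2 : ℝ) ^ (q + 3))⁻¹ := by
          gcongr
          linarith [Real.add_one_le_exp (1 : ℝ)]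
      _ ≤ 1 / (8 * q) := by
          rw [one_div]
          gcongr
          rw [pow_add]
          have : (q : ℝ) ≤ 2 ^ q := by exact_mod_cast Nat.lt_two_pow_self.le
          linarith
  have key := sampleCount_le y ((q + 3) * Z) s
  have : (8 * q * sampleCount y ((q + 3) * Z) s : ℝ) ≤
      9 * (Fintype.card V * q) ^ ((q + 3) * Z) := by
    calc (8 * q * sampleCount y ((q + 3) * Z) s : ℝ)
        ≤ 8 * q * ((Fintype.card V * q) ^ ((q + 3) * Z) * (1 / q + 1 / (8 * q))) := by
          gcongr
          exact key.trans (by gcongr)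
      _ = 9 * (Fintype.card V * q) ^ ((q + 3) * Z) := by
          field_simp
          norm_num
  exact_mod_cast this

/-- A random weighted sample of `(q + 3) Z` positions separates vectors of relative weight at least
`1 / Z` from any fixed value with probability close to `1 - 1 / q`. -/
theorem exists_sampling_rows {F : Type u} [Field F] [Fintype F] [DecidableEq F] {V N : Type}
    [Fintype V] [Fintype N] [Nonempty V] (out : V → N) (Z : ℕ) :
    ∃ (R : Type u) (_ : Fintype R) (_ : Nonempty R) (row : R → N → F),
      (∀ r, hammingNorm (row r) ≤ (Fintype.card F + 3) * Z) ∧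
      ∀ y : N → F, Fintype.card V ≤ Z * hammingNorm (fun v => y (out v)) → ∀ s : F,
        8 * Fintype.card F * #{r | row r ⬝ᵥ y = s} ≤ 9 * Fintype.card R := by
  classical
  refine ⟨Fin ((Fintype.card F + 3) * Z) → V × F, inferInstance, inferInstance,
    fun r => ∑ l, Pi.single (out (r l).1) (r l).2, fun r => ?_, fun y hy s => ?_⟩
  · unfold hammingNorm
    have hsub : (univ.filter fun i => (∑ l, (Pi.single (out (r l).1) (r l).2 : N → F)) i ≠ 0) ⊆
        univ.image fun l => out (r l).1 := by
      intro i hi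
      by_contra hni
      refine (Finset.mem_filter.1 hi).2 ?_
      rw [Finset.sum_apply]
      refine Finset.sum_eq_zero fun l _ => Pi.single_eq_of_ne ?_ _
      rintro rfl
      exact hni (Finset.mem_image_of_mem _ (Finset.mem_univ l))
    exact (Finset.card_le_card hsub).trans (Finset.card_image_le.trans (by simp))
  · have := sampleCount_mul_le (fun v => y (out v)) hy s
    unfold sampleCount at this
    simpa [sum_dotProduct, single_dotProduct, mul_comm (Fintype.card V)] using this

end Sampling

/-! ### Expanders and sparse condensers -/

theorem choose_mul_pow_le (n s : ℕ) : n.choose s * s ^ s ≤ (3 * n) ^ s := by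
  have h1 : (n.choose s : ℝ) ≤ (n ^ s : ℝ) / s.factorial := Nat.choose_le_pow_div s n
  have h2 : (s : ℝ) ^ s / s.factorial ≤ 3 ^ s := by
    refine (Real.pow_div_factorial_le_exp _ (Nat.cast_nonneg s) s).trans ?_
    rw [← mul_one (s : ℝ), Real.exp_nat_mul]
    gcongr
    exact Real.exp_one_lt_three.le
  have hs : (0 : ℝ) < s.factorial := by exact_mod_cast s.factorial_pos
  have : (n.choose s * s ^ s : ℝ) ≤ (3 * n) ^ s := by
    calc (n.choose s * s ^ s : ℝ) ≤ (n ^ s : ℝ) / s.factorial * s ^ s := by gcongr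
      _ = n ^ s * (s ^ s / s.factorial) := by ring
      _ ≤ n ^ s * 3 ^ s := by gcongr
      _ = _ := by rw [← mul_pow, mul_comm]
  exact_mod_cast this

/-- First-moment bound: a random graph of left degree `9` sends some `w`-set into some `5 w`-set
with probability at most `2 ^ (-w)`. The constant covers `2 * 3 * 3 ^ 5 * 5 ^ 4 = 911250`. -/
theorem choose_mul_choose_mul_pow_le {n m w : ℕ} (hw : 1 ≤ w) (hm : 1000000 * n * w ^ 3 ≤ m ^ 4) :
    2 ^ w * (n.choose w * m.choose (5 * w) * (5 * w) ^ (9 * w)) ≤ m ^ (9 * w) := by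
  have h1 := choose_mul_pow_le n w
  have h2 := choose_mul_pow_le m (5 * w)
  have hw0 : 0 < w ^ w := by positivity
  refine Nat.le_of_mul_le_mul_left ?_ hw0
  calc w ^ w * (2 ^ w * (n.choose w * m.choose (5 * w) * (5 * w) ^ (9 * w)))
      = 2 ^ w * ((n.choose w * w ^ w) * (m.choose (5 * w) * (5 * w) ^ (5 * w)) *
          (5 * w) ^ (4 * w)) := by
        rw [show 9 * w = 5 * w + 4 * w by ring, pow_add]
        ring
    _ ≤ 2 ^ w * ((3 * n) ^ w * (3 * m) ^ (5 * w) * (5 * w) ^ (4 * w)) := by gcongr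
    _ = (2 * ((3 * n) * (3 * m) ^ 5 * (5 * w) ^ 4)) ^ w := by
        rw [pow_mul (3 * m), pow_mul (5 * w), ← mul_pow, ← mul_pow, ← mul_pow]
    _ ≤ (w * m ^ 9) ^ w := by
        refine Nat.pow_le_pow_left ?_ w
        calc 2 * ((3 * n) * (3 * m) ^ 5 * (5 * w) ^ 4) = 911250 * n * w ^ 3 * (w * m ^ 5) := by ring
          _ ≤ 1000000 * n * w ^ 3 * (w * m ^ 5) := by gcongr; norm_num
          _ ≤ m ^ 4 * (w * m ^ 5) := by gcongr
          _ = _ := by ring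
    _ = w ^ w * m ^ (9 * w) := by rw [mul_pow, pow_mul]

theorem card_functions_into {n m : ℕ} (S : Finset (Fin n)) (T : Finset (Fin m)) :
    #(Fintype.piFinset fun p : Fin n × Fin 9 => if p.1 ∈ S then T else univ) =
      #T ^ (9 * #S) * m ^ (9 * (n - #S)) := by
  rw [Fintype.card_piFinset, Fintype.prod_prod_type]
  have : ∀ x : Fin n, ∏ _l : Fin 9, #(if x ∈ S then T else univ) =
      if x ∈ S then #T ^ 9 else m ^ 9 := by
    intro x
    split_ifs <;> simp
  rw [Finset.prod_congr rfl fun x _ => this x, Finset.prod_ite, Finset.prod_const,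
    Finset.prod_const, Finset.filter_mem_eq_inter, Finset.univ_inter]
  rw [← pow_mul, ← pow_mul]
  congr 3
  have h := Finset.card_filter_add_card_filter_not (s := (univ : Finset (Fin n))) (· ∈ S)
  simp only [Finset.filter_mem_eq_inter, Finset.univ_inter, Finset.card_univ,
    Fintype.card_fin] at h
  omega

/-- Unbalanced bipartite graphs of left degree `9` in which small sets expand by a factor `5`. -/
theorem exists_expander {n m s : ℕ} (hs : s ≤ n) (hm1 : 0 < m)
    (hm : 1000000 * n * s ^ 3 ≤ m ^ 4) :
    ∃ e : Fin n × Fin 9 → Fin m, ∀ S : Finset (Fin n), #S ≤ s →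
      5 * #S ≤ #((S ×ˢ univ).image e) := by
  classical
  by_contra! hcon
  -- Needed to enlarge a too small neighbourhood to exactly `5 * #S` vertices.
  have hsm : 5 * s ≤ m := by
    by_contra! h
    have h1 : m ^ 4 < (5 * s) ^ 4 := Nat.pow_lt_pow_left h (by norm_num)
    have h2 : s * s ^ 3 ≤ n * s ^ 3 := by gcongr
    nlinarith [Nat.zero_le (n * s ^ 3)]
  have hsub : (univ : Finset (Fin n × Fin 9 → Fin m)) ⊆ (Icc 1 s).biUnion fun w =>
      (powersetCard w univ ×ˢ powersetCard (5 * w) univ).biUnion fun ST =>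
        Fintype.piFinset fun p : Fin n × Fin 9 => if p.1 ∈ ST.1 then ST.2 else univ := by
    intro e _
    obtain ⟨S, hS, hlt⟩ := hcon e
    obtain ⟨T, hT, hTc⟩ := Finset.exists_superset_card_eq hlt.le
      (by rw [Fintype.card_fin]; omega)
    simp only [Finset.mem_biUnion, Finset.mem_product, Finset.mem_powersetCard,
      Fintype.mem_piFinset, Finset.mem_Icc]
    refine ⟨#S, ⟨by omega, hS⟩, (S, T), ⟨⟨Finset.subset_univ _, rfl⟩,
      ⟨Finset.subset_univ _, hTc⟩⟩, fun p => ?_⟩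
    split_ifs with hp
    · exact hT (Finset.mem_image_of_mem _ (by simpa using hp))
    · exact Finset.mem_univ _
  have h1 := (Finset.card_le_card hsub).trans Finset.card_biUnion_le
  have h2 : ∀ w ∈ Icc 1 s, (#((powersetCard w univ ×ˢ powersetCard (5 * w) univ).biUnion fun ST :
        Finset (Fin n) × Finset (Fin m) =>
        Fintype.piFinset fun p : Fin n × Fin 9 => if p.1 ∈ ST.1 then ST.2 else univ) : ℝ) ≤
      (m : ℝ) ^ (9 * n) * (1 / 2) ^ w := by
    intro w hw
    obtain ⟨hw1, hws⟩ := Finset.mem_Icc.1 hw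
    have h3 : #((powersetCard w univ ×ˢ powersetCard (5 * w) univ).biUnion fun ST :
        Finset (Fin n) × Finset (Fin m) =>
        Fintype.piFinset fun p : Fin n × Fin 9 => if p.1 ∈ ST.1 then ST.2 else univ) ≤
        (n.choose w * m.choose (5 * w)) * ((5 * w) ^ (9 * w) * m ^ (9 * (n - w))) := by
      refine (Finset.card_biUnion_le_card_mul _ _
        ((5 * w) ^ (9 * w) * m ^ (9 * (n - w))) fun ST hST => ?_).trans_eq ?_
      · simp only [Finset.mem_product, Finset.mem_powersetCard] at hST
        rw [card_functions_into, hST.1.2, hST.2.2]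
      · simp
    have h4 := choose_mul_choose_mul_pow_le hw1 (hm.trans' (by gcongr) : 1000000 * n * w ^ 3 ≤ _)
    have h5 : 2 ^ w * ((n.choose w * m.choose (5 * w)) * ((5 * w) ^ (9 * w) * m ^ (9 * (n - w))))
        ≤ m ^ (9 * n) := by
      calc _ = 2 ^ w * (n.choose w * m.choose (5 * w) * (5 * w) ^ (9 * w)) * m ^ (9 * (n - w)) := by
            ring
        _ ≤ m ^ (9 * w) * m ^ (9 * (n - w)) := by gcongr
        _ = m ^ (9 * n) := by
            rw [← pow_add]
            congr 1
            omega
    have h6 := (Nat.mul_le_mul_left (2 ^ w) h3).trans h5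
    rw [one_div, inv_pow, ← div_eq_mul_inv, le_div_iff₀ (by positivity), mul_comm]
    exact_mod_cast h6
  have h7 : ((m : ℝ) ^ (9 * n)) ≤ ∑ w ∈ Icc 1 s, (m : ℝ) ^ (9 * n) * (1 / 2) ^ w := by
    refine le_trans ?_ (Finset.sum_le_sum h2)
    have : #(univ : Finset (Fin n × Fin 9 → Fin m)) = m ^ (9 * n) := by
      simp [mul_comm]
    rw [this] at h1
    exact_mod_cast h1
  -- The failure probabilities sum to less than `1`; the empty set never fails, so `w` starts at
  -- `1`.
  have hgeom : ∀ s : ℕ, ∑ w ∈ Icc 1 s, (1 / 2 : ℝ) ^ w = 1 - (1 / 2) ^ s := by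
    intro s
    induction s with
    | zero => simp
    | succ s ih =>
      rw [Finset.sum_Icc_succ_top (by omega), ih, pow_succ]
      ring
  rw [← Finset.mul_sum, hgeom] at h7
  have : (0 : ℝ) < (m : ℝ) ^ (9 * n) * (1 / 2) ^ s := by positivity
  linarith

/-- A sparse linear map that does not decrease the weight of vectors of weight at most `s`. -/
theorem exists_sparse_condenser (F : Type*) [Field F] [DecidableEq F] {n m s : ℕ} (hs : s ≤ n)
    (hm1 : 0 < m) (hm : 1000000 * n * s ^ 3 ≤ m ^ 4) :
    ∃ A : Matrix (Fin m) (Fin n) F, ∑ j, hammingNorm (A j) ≤ 9 * n ∧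
      ∀ x, hammingNorm x ≤ s → hammingNorm x ≤ hammingNorm (A.mulVec x) := by
  classical
  obtain ⟨e, he⟩ := exists_expander hs hm1 hm
  let adj : Fin m → Fin n → Prop := fun j i => ∃ l, e (i, l) = j
  have hdeg : ∀ i, #{j | adj j i} ≤ 9 := by
    intro i
    have : (univ.filter fun j => adj j i) = univ.image fun l => e (i, l) := by
      ext j
      simp [adj]
    rw [this]
    exact Finset.card_image_le.trans (by simp)
  refine ⟨fun j i => if adj j i then 1 else 0, ?_, fun x hx => ?_⟩
  · have : ∀ j : Fin m, hammingNorm (fun i => if adj j i then (1 : F) else 0) =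
        ∑ i, if adj j i then 1 else 0 := by
      intro j
      unfold hammingNorm
      rw [Finset.card_filter]
      simp
    rw [Finset.sum_congr rfl fun j _ => this j, Finset.sum_comm]
    calc ∑ i, ∑ j, (if adj j i then 1 else 0) ≤ ∑ i : Fin n, 9 :=
          Finset.sum_le_sum fun i _ => by simpa [Finset.card_filter] using hdeg i
      _ = 9 * n := by simp [mul_comm]
  · set S : Finset (Fin n) := univ.filter fun i => x i ≠ 0 with hS
    have hSx : hammingNorm x = #S := rfl
    set deg : Fin m → ℕ := fun j => #{i ∈ S | adj j i} with hdegdef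
    have hN := he S (hSx ▸ hx)
    have hNdeg : ((S ×ˢ univ).image e) = univ.filter fun j => 1 ≤ deg j := by
      ext j
      simp only [Finset.mem_image, Finset.mem_product, Finset.mem_univ, and_true, Prod.exists,
        Finset.mem_filter, true_and, hdegdef, Finset.one_le_card]
      constructor
      · rintro ⟨i, l, hi, hj⟩
        exact ⟨i, by simp [hi, adj]; exact ⟨l, hj⟩⟩
      · rintro ⟨i, hi⟩
        obtain ⟨hiS, l, hl⟩ := Finset.mem_filter.1 hi
        exact ⟨i, l, hiS, hl⟩
    have hsum : ∑ j, deg j ≤ 9 * #S := by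
      simp only [hdegdef, Finset.card_filter]
      rw [Finset.sum_comm]
      calc ∑ i ∈ S, ∑ j, (if adj j i then 1 else 0) ≤ ∑ i ∈ S, 9 :=
            Finset.sum_le_sum fun i _ => by simpa [Finset.card_filter] using hdeg i
        _ = 9 * #S := by simp [mul_comm]
    -- At least `2 * 5 * #S - 9 * #S = #S` vertices have exactly one neighbour in the support. No
    -- cancellation can occur there.
    have huniq : 2 * #{j | 1 ≤ deg j} ≤ ∑ j, deg j + #{j | deg j = 1} := by
      rw [Finset.card_filter, Finset.card_filter, Finset.mul_sum, ← Finset.sum_add_distrib]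
      refine Finset.sum_le_sum fun j _ => ?_
      split_ifs <;> omega
    have hle : #{j | deg j = 1} ≤
        hammingNorm (Matrix.mulVec (fun j i => if adj j i then (1 : F) else 0) x) := by
      unfold hammingNorm
      refine Finset.card_le_card fun j hj => ?_
      obtain ⟨i, hi⟩ := Finset.card_eq_one.1 (Finset.mem_filter.1 hj).2
      have hiS : i ∈ S ∧ adj j i := Finset.mem_filter.1 (hi ▸ Finset.mem_singleton_self i)
      refine Finset.mem_filter.2 ⟨Finset.mem_univ _, ?_⟩
      have : Matrix.mulVec (fun j i => if adj j i then (1 : F) else 0) x j = x i := by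
        unfold Matrix.mulVec dotProduct
        rw [Finset.sum_eq_single i]
        · simp [hiS.2]
        · intro b _ hb
          by_cases hxb : x b = 0
          · simp [hxb]
          · have : ¬ adj j b := fun hadj => hb (by
              have : b ∈ ({i} : Finset (Fin n)) := by
                rw [← hi]
                simp [hS, hxb, hadj]
              simpa using this)
            simp [this]
        · simp
      rw [this]
      exact (Finset.mem_filter.1 hiS.1).2
    rw [hNdeg] at hN
    rw [hSx]
    omega

/-! ### Samplers and codes -/

section Samplers

/-- There is a circuit of depth `d` and size `S`, together with a random row of support at most `c`
on its nodes, such that for each input in `P` the random row takes any given value on the nodes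
with probability at most `9 / (8 q)`. -/
def HasSampler (F : Type u) [Field F] [Fintype F] [DecidableEq F] (n d S c : ℕ)
    (P : Set (Fin n → F)) : Prop :=
  ∃ (C : Circ F (Fin n)) (R : Type u) (_ : Fintype R) (_ : Nonempty R)
    (row : R → Fin n ⊕ C.G → F),
    (∀ g, C.level g ≤ d) ∧ C.size ≤ S ∧ (∀ r, hammingNorm (row r) ≤ c) ∧
      ∀ x ∈ P, ∀ s, 8 * Fintype.card F * #{r | row r ⬝ᵥ C.val x = s} ≤ 9 * Fintype.card R

/-- There is a circuit of depth `d` and size `S` with `8 k` distinct output gates, at least `k` of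
which are nonzero on each input in `P`. -/
def HasCode (F : Type u) [Field F] [DecidableEq F] (n d S k : ℕ) (P : Set (Fin n → F)) : Prop :=
  ∃ (C : Circ F (Fin n)) (out : Fin (8 * k) → C.G), Function.Injective out ∧
    (∀ g, C.level g ≤ d) ∧ C.size ≤ S ∧
      ∀ x ∈ P, k ≤ hammingNorm (fun j => C.val x (Sum.inr (out j)))

variable {F : Type u} [Field F] [Fintype F] [DecidableEq F] {n m d S c k : ℕ}
  {P : Set (Fin n → F)}

theorem HasSampler.mono {d' S' c' : ℕ} {P' : Set (Fin n → F)} (h : HasSampler F n d S c P)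
    (hd : d ≤ d') (hS : S ≤ S') (hc : c ≤ c') (hP : P' ⊆ P) : HasSampler F n d' S' c' P' := by
  obtain ⟨C, R, i1, i2, row, h1, h2, h3, h4⟩ := h
  exact ⟨C, R, i1, i2, row, fun g => (h1 g).trans hd, h2.trans hS, fun r => (h3 r).trans hc,
    fun x hx => h4 x (hP hx)⟩

omit [Fintype F] in
theorem HasCode.mono {d' S' : ℕ} {P' : Set (Fin n → F)} (h : HasCode F n d S k P)
    (hd : d ≤ d') (hS : S ≤ S') (hP : P' ⊆ P) : HasCode F n d' S' k P' := by
  obtain ⟨C, out, h0, h1, h2, h3⟩ := h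
  exact ⟨C, out, h0, fun g => (h1 g).trans hd, h2.trans hS, fun x hx => h3 x (hP hx)⟩

omit [Fintype F] in
-- Fix the first component: the second must then hit `s - f r₁`. For this reason samplers control
-- every value and not only `0`.
theorem card_prod_filter_add_le {R₁ R₂ : Type*} [Fintype R₁] [Fintype R₂] (f : R₁ → F) (g : R₂ → F)
    {a b : ℕ} (hg : ∀ s, a * #{r | g r = s} ≤ b * Fintype.card R₂) (s : F) :
    a * #{r : R₁ × R₂ | f r.1 + g r.2 = s} ≤ b * Fintype.card (R₁ × R₂) := by
  rw [Finset.card_filter, Fintype.sum_prod_type, Finset.mul_sum, Fintype.card_prod]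
  calc ∑ r₁, a * ∑ r₂, (if f r₁ + g r₂ = s then 1 else 0)
      ≤ ∑ _r₁ : R₁, b * Fintype.card R₂ := by
        refine Finset.sum_le_sum fun r₁ _ => ?_
        refine le_trans (le_of_eq ?_) (hg (s - f r₁))
        rw [Finset.card_filter]
        congr 1
        refine Finset.sum_congr rfl fun r₂ _ => ?_
        congr 1
        rw [eq_sub_iff_add_eq, add_comm]
    _ = b * (Fintype.card R₁ * Fintype.card R₂) := by simp; ring

theorem HasSampler.union {S₁ S₂ c₁ c₂ : ℕ} {P₁ P₂ : Set (Fin n → F)}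
    (h₁ : HasSampler F n d S₁ c₁ P₁) (h₂ : HasSampler F n d S₂ c₂ P₂) :
    HasSampler F n d (S₁ + S₂) (c₁ + c₂) (P₁ ∪ P₂) := by
  obtain ⟨C₁, R₁, i1, i1', row₁, hd₁, hS₁, hc₁, hP₁⟩ := h₁
  obtain ⟨C₂, R₂, i2, i2', row₂, hd₂, hS₂, hc₂, hP₂⟩ := h₂
  let row : R₁ × R₂ → Fin n ⊕ (Circ.union C₁ C₂).G → F := fun r =>
    Sum.elim (β := C₁.G ⊕ C₂.G) (fun i => row₁ r.1 (Sum.inl i) + row₂ r.2 (Sum.inl i))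
      (Sum.elim (fun g => row₁ r.1 (Sum.inr g)) (fun g => row₂ r.2 (Sum.inr g)))
  have hrow : ∀ r x, row r ⬝ᵥ (Circ.union C₁ C₂).val x =
      row₁ r.1 ⬝ᵥ C₁.val x + row₂ r.2 ⬝ᵥ C₂.val x := by
    intro r x
    have h0 := Fintype.sum_sum_type fun v => row r v * (Circ.union C₁ C₂).val x v
    have h1 := Fintype.sum_sum_type (α₁ := C₁.G) (α₂ := C₂.G)
      fun g => row r (Sum.inr g) * (Circ.union C₁ C₂).val x (Sum.inr g)
    have h2 : ∑ i, row r (Sum.inl i) * (Circ.union C₁ C₂).val x (Sum.inl i) =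
        ∑ i, (row₁ r.1 (Sum.inl i) + row₂ r.2 (Sum.inl i)) * x i :=
      Finset.sum_congr rfl fun i _ => congrArg₂ _ rfl (Circ.val_inl _ _ _)
    have h3 : ∑ g : C₁.G, row r (Sum.inr (Sum.inl g)) * (Circ.union C₁ C₂).val x
        (Sum.inr (Sum.inl g)) = ∑ g, row₁ r.1 (Sum.inr g) * C₁.val x (Sum.inr g) := rfl
    have h4 : ∑ g : C₂.G, row r (Sum.inr (Sum.inr g)) * (Circ.union C₁ C₂).val x
        (Sum.inr (Sum.inr g)) = ∑ g, row₂ r.2 (Sum.inr g) * C₂.val x (Sum.inr g) := rfl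
    refine h0.trans ((congrArg₂ _ h2 (h1.trans (congrArg₂ _ h3 h4))).trans ?_)
    simp only [dotProduct, Fintype.sum_sum_type, Circ.val_inl, add_mul, Finset.sum_add_distrib]
    ring
  refine ⟨Circ.union C₁ C₂, R₁ × R₂, inferInstance, inferInstance, row, ?_, ?_, fun r => ?_, ?_⟩
  · rintro (g | g)
    · exact hd₁ g
    · exact hd₂ g
  · rw [Circ.size_union]
    omega
  · have h1 := hc₁ r.1
    have h2 := hc₂ r.2
    rw [Circ.hammingNorm_split] at h1 h2
    have h3 : hammingNorm (fun i => row₁ r.1 (Sum.inl i) + row₂ r.2 (Sum.inl i)) ≤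
        hammingNorm (fun i => row₁ r.1 (Sum.inl i)) + hammingNorm fun i => row₂ r.2 (Sum.inl i) := by
      classical
      unfold hammingNorm
      refine (Finset.card_le_card fun i hi => ?_).trans (Finset.card_union_le _ _)
      simp only [Finset.mem_union, Finset.mem_filter, Finset.mem_univ, true_and] at hi ⊢
      by_contra! h
      exact hi (by rw [h.1, h.2, add_zero])
    have h4 : hammingNorm (row r) = _ :=
      (Circ.hammingNorm_sumElim _ _).trans (congrArg _ (Circ.hammingNorm_sumElim _ _))
    omega
  · intro x hx s
    simp only [hrow]
    rcases hx with hx | hx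
    · have := card_prod_filter_add_le (fun r => row₂ r ⬝ᵥ C₂.val x) (fun r => row₁ r ⬝ᵥ C₁.val x)
        (hP₁ x hx) s
      rw [Fintype.card_prod, mul_comm (Fintype.card R₁), ← Fintype.card_prod]
      refine le_trans (le_of_eq ?_) this
      congr 1
      refine Finset.card_equiv (Equiv.prodComm _ _) fun r => ?_
      simp [add_comm]
    · exact card_prod_filter_add_le (fun r => row₁ r ⬝ᵥ C₁.val x) (fun r => row₂ r ⬝ᵥ C₂.val x)
        (hP₂ x hx) s

/-- The fixed rows become a new layer of gates; a row is bad for an input on which it vanishes. -/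
theorem HasSampler.hasCode (h : HasSampler F n d S c P) (hP : P.ncard < Fintype.card F ^ k) :
    HasCode F n (d + 1) (S + 8 * k * c) k P := by
  classical
  obtain ⟨C, R, i1, i1', row, hd, hS, hc, hrow⟩ := h
  obtain ⟨r, hr⟩ := exists_rows_of_bad_fraction_le (J := Fin (8 * k)) (k := k)
    (Fintype.one_lt_card : 1 < Fintype.card F) (by simp) (fun r x => row r ⬝ᵥ C.val x ≠ 0)
    P.toFinite.toFinset (fun x hx => by simpa using hrow x (by simpa using hx) 0)
    (by rwa [← Set.ncard_eq_toFinset_card])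
  refine ⟨C.append d hd fun j => row (r j), Sum.inr, Sum.inr_injective, ?_, ?_, fun x hx => ?_⟩
  · rintro (g | g)
    · exact (hd g).trans (Nat.le_succ d)
    · exact le_rfl
  · rw [Circ.size_append]
    refine Nat.add_le_add hS ((Finset.sum_le_sum fun j _ => hc (r j)).trans ?_)
    simp
  · refine (hr x (by simpa using hx)).trans (le_of_eq ?_)
    unfold hammingNorm
    congr 1
    refine Finset.filter_congr fun j _ => ?_
    exact iff_of_eq (congrArg (· ≠ 0) (Circ.append_val C d hd (fun j => row (r j)) x j).symm)

/-- At least one eighth of the outputs are nonzero, so samples with `Z = 8` suffice. The random row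
is not itself a gate, hence the depth is unchanged. -/
theorem HasCode.hasSampler (h : HasCode F n d S k P) (hk : 0 < k) :
    HasSampler F n d S ((Fintype.card F + 3) * 8) P := by
  obtain ⟨C, out, -, hd, hS, hP⟩ := h
  have : Nonempty (Fin (8 * k)) := ⟨⟨0, by omega⟩⟩
  obtain ⟨R, i1, i2, row, hc, hrow⟩ := exists_sampling_rows (F := F)
    (fun j => (Sum.inr (out j) : Fin n ⊕ C.G)) 8
  exact ⟨C, R, i1, i2, row, hd, hS, hc, fun x hx =>
    hrow (C.val x) (by simpa using hP x hx)⟩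

omit [Fintype F] in
theorem HasCode.precomp {P : Set (Fin m → F)} (h : HasCode F m d S k P)
    (A : Matrix (Fin m) (Fin n) F) {D : ℕ} (hA : ∑ j, hammingNorm (A j) ≤ D) :
    HasCode F n (d + 1) (D + S) k {x | A.mulVec x ∈ P} := by
  obtain ⟨C, out, hout, hd, hS, hP⟩ := h
  refine ⟨C.precomp A, fun j => Sum.inr (out j), Sum.inr_injective.comp hout, ?_, ?_,
    fun x hx => hP _ hx⟩
  · rintro (g | g)
    · exact Nat.le_add_left _ _
    · exact Nat.succ_le_succ (hd g)
  · rw [Circ.size_precomp]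
    omega

theorem hasSampler_of_heavy (F : Type u) [Field F] [Fintype F] [DecidableEq F] {n : ℕ} (hn : 1 ≤ n)
    (Z : ℕ) : HasSampler F n 0 0 ((Fintype.card F + 3) * Z) {x | n ≤ Z * hammingNorm x} := by
  have : Nonempty (Fin n) := ⟨⟨0, by omega⟩⟩
  obtain ⟨R, i1, i2, row, hc, hrow⟩ := exists_sampling_rows (F := F)
    (fun j : Fin n => (Sum.inl j : Fin n ⊕ (Circ.empty F (Fin n)).G)) Z
  refine ⟨Circ.empty F (Fin n), R, i1, i2, row, fun g => Empty.elim g, Circ.size_empty.le, hc,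
    fun x hx => hrow _ ?_⟩
  simpa [Circ.val_inl] using hx

/-- There are only `q ^ n < q ^ (4 n)` inputs, so any class is admissible. -/
theorem HasSampler.hasCode_four (h : HasSampler F n d S c P) (hn : 1 ≤ n) :
    HasCode F n (d + 1) (S + 32 * n * c) (4 * n) P := by
  refine (h.hasCode (k := 4 * n) ?_).mono le_rfl (by exact le_of_eq (by ring)) subset_rfl
  calc P.ncard ≤ Fintype.card F ^ n := by
        refine (Set.ncard_le_card P).trans (by simp)
    _ < Fintype.card F ^ (4 * n) :=
        Nat.pow_lt_pow_right Fintype.one_lt_card (by omega)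

theorem ncard_hammingNorm_le (s : ℕ) (hs : s ≤ n) :
    {x : Fin n → F | hammingNorm x ≤ s}.ncard ≤ n.choose s * Fintype.card F ^ s := by
  classical
  rw [Set.ncard_eq_toFinset_card']
  have hsub : Set.toFinset {x : Fin n → F | hammingNorm x ≤ s} ⊆
      (powersetCard s (univ : Finset (Fin n))).biUnion fun T =>
        Fintype.piFinset fun i => if i ∈ T then (univ : Finset F) else {0} := by
    intro x hx
    have hx' : hammingNorm x ≤ s := by simpa using hx
    obtain ⟨T, hT, hTc⟩ := Finset.exists_superset_card_eq hx' (by simpa using hs)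
    simp only [Finset.mem_biUnion, Finset.mem_powersetCard, Fintype.mem_piFinset]
    refine ⟨T, ⟨Finset.subset_univ _, hTc⟩, fun i => ?_⟩
    split_ifs with hi
    · exact Finset.mem_univ _
    · by_contra hne
      exact hi (hT (by simpa using hne))
  refine (Finset.card_le_card hsub).trans
    ((Finset.card_biUnion_le_card_mul _ _ (Fintype.card F ^ s) fun T hT => ?_).trans_eq ?_)
  · rw [Fintype.card_piFinset]
    have : ∀ i : Fin n, #(if i ∈ T then (univ : Finset F) else {0}) =
        if i ∈ T then Fintype.card F else 1 := by
      intro i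
      split_ifs <;> simp
    rw [Finset.prod_congr rfl fun i _ => this i, Finset.prod_ite, Finset.prod_const,
      Finset.prod_const, Finset.filter_mem_eq_inter, Finset.univ_inter,
      (Finset.mem_powersetCard.1 hT).2]
    simp
  · simp

/-- The depth-one sampler for inputs whose relative weight is about `2 ^ (-i)`. -/
theorem hasSampler_of_weight_range (F : Type u) [Field F] [Fintype F] [DecidableEq F] {n : ℕ}
    (i : ℕ) (hi : 2 ^ i ≤ n) :
    HasSampler F n 1 (16 * (Fintype.card F + 3) * (i + 5) * n) ((Fintype.card F + 3) * 8)
      {x | n ≤ 2 * 2 ^ i * hammingNorm x ∧ 2 ^ i * hammingNorm x ≤ n} := by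
  have h2 : 0 < 2 ^ i := by positivity
  have hn : 1 ≤ n := by omega
  set s := n / 2 ^ i with hs
  have hs1 : 1 ≤ s := (Nat.one_le_div_iff h2).2 hi
  have hsn : 2 ^ i * s ≤ n := Nat.mul_div_le n _
  have hns : n ≤ 2 * 2 ^ i * s := by
    have := Nat.lt_mul_div_succ n h2
    rw [← hs] at this
    nlinarith
  have hF : 2 ≤ Fintype.card F := Fintype.one_lt_card
  -- Light inputs are few, so few of the long rows are needed. Supports number at most `(3 n / s) ^
  -- s ≤ 2 ^ ((i + 3) s)`, the entries contribute `q ^ s`, and one more factor `q ^ s` makes the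
  -- bound strict.
  have key : {x : Fin n → F | n ≤ 2 * 2 ^ i * hammingNorm x ∧ 2 ^ i * hammingNorm x ≤ n}.ncard <
      Fintype.card F ^ ((i + 5) * s) := by
    have hsub : {x : Fin n → F | n ≤ 2 * 2 ^ i * hammingNorm x ∧ 2 ^ i * hammingNorm x ≤ n} ⊆
        {x : Fin n → F | hammingNorm x ≤ s} := fun x hx => by
      rw [Set.mem_ofPred_eq, hs, Nat.le_div_iff_mul_le h2, mul_comm]
      exact hx.2
    have hch : n.choose s ≤ (2 ^ (i + 3)) ^ s := by
      refine Nat.le_of_mul_le_mul_right ?_ (show 0 < s ^ s by positivity)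
      refine (choose_mul_pow_le n s).trans ?_
      rw [← mul_pow]
      refine Nat.pow_le_pow_left ?_ s
      rw [pow_add]
      nlinarith
    calc _ ≤ {x : Fin n → F | hammingNorm x ≤ s}.ncard := Set.ncard_le_ncard hsub
      _ ≤ n.choose s * Fintype.card F ^ s :=
          ncard_hammingNorm_le s (Nat.div_le_self _ _)
      _ ≤ (Fintype.card F ^ (i + 3)) ^ s * Fintype.card F ^ s := by
          gcongr
          exact hch.trans (by gcongr)
      _ = Fintype.card F ^ ((i + 4) * s) := by rw [← pow_mul, ← pow_add]; ring_nf
      _ < Fintype.card F ^ ((i + 5) * s) :=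
          Nat.pow_lt_pow_right Fintype.one_lt_card (by nlinarith)
  have h := ((hasSampler_of_heavy F hn (2 * 2 ^ i)).mono le_rfl le_rfl le_rfl
    (fun x hx => hx.1)).hasCode key
  refine (h.hasSampler (by positivity)).mono le_rfl ?_ le_rfl subset_rfl
  calc 0 + 8 * ((i + 5) * s) * ((Fintype.card F + 3) * (2 * 2 ^ i))
      = 16 * (Fintype.card F + 3) * (i + 5) * (2 ^ i * s) := by ring
    _ ≤ _ := by gcongr

/-! ### Iterated functions and the inverse Ackermann function -/

section Star

variable {f : ℕ → ℕ}

theorem iterStar_of_le_one {X : ℕ} (hX : X ≤ 1) : iterStar f X = 0 :=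
  Nat.sInf_eq_zero.2 (Or.inl (by simpa using hX))

theorem exists_iterate_le_one (hf : ∀ X, 2 ≤ X → 1 ≤ f X ∧ f X < X) (X : ℕ) :
    {i : ℕ | f^[i] X ≤ 1}.Nonempty := by
  induction X using Nat.strong_induction_on with
  | _ X ih =>
    rcases Nat.lt_or_ge X 2 with h | h
    · exact ⟨0, by simpa using Nat.lt_succ_iff.1 h⟩
    · obtain ⟨i, hi⟩ := ih (f X) (hf X h).2
      exact ⟨i + 1, hi⟩

theorem iterStar_step (hf : ∀ X, 2 ≤ X → 1 ≤ f X ∧ f X < X) {X : ℕ} (hX : 2 ≤ X) :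
    iterStar f X = iterStar f (f X) + 1 := by
  apply le_antisymm
  · exact Nat.sInf_le (Nat.sInf_mem (exists_iterate_le_one hf (f X)) :)
  · have hmem : f^[iterStar f X] X ≤ 1 := Nat.sInf_mem (exists_iterate_le_one hf X)
    rcases h : iterStar f X with _ | j
    · rw [h] at hmem
      simp at hmem
      omega
    · rw [h] at hmem
      exact Nat.succ_le_succ (Nat.sInf_le hmem)

theorem iterStar_lt (hf : ∀ X, 2 ≤ X → 1 ≤ f X ∧ f X < X) {X : ℕ} (hX : 1 ≤ X) :
    iterStar f X < X := by
  induction X using Nat.strong_induction_on with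
  | _ X ih =>
    rcases Nat.lt_or_ge X 2 with h | h
    · rw [iterStar_of_le_one (by omega)]
      omega
    · rw [iterStar_step hf h]
      have := ih (f X) (hf X h).2 (hf X h).1
      have := (hf X h).2
      omega

end Star

theorem lambdaFn_pos_and_lt (d : ℕ) : ∀ X, 2 ≤ X → 1 ≤ lambdaFn (d + 1) X ∧ lambdaFn (d + 1) X < X := by
  induction d using Nat.twoStepInduction with
  | zero =>
    intro X hX
    exact ⟨Nat.sqrt_pos.2 (by omega), Nat.sqrt_lt_self (by omega)⟩
  | one =>
    intro X hX
    refine ⟨Nat.clog_pos (by omega) hX, ?_⟩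
    have h : Nat.clog 2 X ≤ X - 1 := by
      refine Nat.clog_le_of_le_pow ?_
      have := Nat.lt_two_pow_self (n := X - 1)
      omega
    exact lt_of_le_of_lt h (by omega)
  | more d ih _ =>
    intro X hX
    refine ⟨?_, iterStar_lt ih (by omega)⟩
    exact (Nat.le_add_left _ _).trans_eq (iterStar_step ih hX).symm

/-- A drop by two, rather than one, outweighs the `+ 1` of the star recursion. -/
theorem lambdaFn_even_add_two_le (j : ℕ) : ∀ X, 4 ≤ X → lambdaFn (2 * j + 2) X + 2 ≤ X := by
  induction j with
  | zero =>
    intro X hX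
    have h : Nat.clog 2 X ≤ X - 2 := by
      refine Nat.clog_le_of_le_pow ?_
      obtain ⟨k, rfl⟩ := Nat.exists_eq_add_of_le hX
      have := Nat.lt_two_pow_self (n := k)
      rw [show 4 + k - 2 = k + 2 by omega, pow_add]
      omega
    have h' : lambdaFn (2 * 0 + 2) X = Nat.clog 2 X := rfl
    omega
  | succ j ih =>
    intro X hX
    have hf := lambdaFn_pos_and_lt (2 * j + 1)
    have h1 : lambdaFn (2 * (j + 1) + 2) X = iterStar (lambdaFn (2 * j + 2)) X := rfl
    have h2 := iterStar_step hf (X := X) (by omega)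
    have h3 := iterStar_lt hf (hf X (by omega)).1
    have h4 := ih X hX
    simp only [Nat.add_assoc] at h2 h3
    norm_num at h2 h3
    omega

/-- With `Y = λ_{2j+2}(n)` one has `λ_{2j+4}(n) = λ_{2j+4}(Y) + 1`, which is at most `Y - 1` for `Y
≥ 4`. So the values fall strictly while they exceed `6`, and the infimum in `invAckermann` is
attained. -/
theorem exists_lambdaFn_le_six (n : ℕ) : ∃ d, 0 < d ∧ Even d ∧ lambdaFn d n ≤ 6 := by
  have key : ∀ j, lambdaFn (2 * j + 2) n ≤ 6 ∨ lambdaFn (2 * j + 2) n + j ≤ n + 6 := by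
    intro j
    induction j with
    | zero =>
      rcases Nat.lt_or_ge n 2 with h | h
      · left
        interval_cases n <;> simp [lambdaFn]
      · right
        have : lambdaFn 2 n < n := (lambdaFn_pos_and_lt 1 n h).2
        simp only [Nat.mul_zero, Nat.zero_add]
        omega
    | succ j ih =>
      by_cases h6 : lambdaFn (2 * (j + 1) + 2) n ≤ 6
      · exact Or.inl h6
      right
      have hf := lambdaFn_pos_and_lt (2 * j + 1)
      have h1 : lambdaFn (2 * (j + 1) + 2) n = iterStar (lambdaFn (2 * j + 2)) n := rfl
      have hn : 2 ≤ n := by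
        by_contra hlt
        rw [h1, iterStar_of_le_one (by omega)] at h6
        omega
      have h2 : iterStar (lambdaFn (2 * j + 2)) n = _ := iterStar_step hf hn
      have h3 : iterStar (lambdaFn (2 * j + 2)) (lambdaFn (2 * j + 2) n) < _ :=
        iterStar_lt hf (hf n hn).1
      have h4 := lambdaFn_even_add_two_le (j + 1) (lambdaFn (2 * j + 2) n)
      have h5 : lambdaFn (2 * (j + 1) + 2) (lambdaFn (2 * j + 2) n) =
        iterStar (lambdaFn (2 * j + 2)) (lambdaFn (2 * j + 2) n) := rfl
      simp only [Nat.add_assoc] at h2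
      norm_num at h2
      omega
  refine ⟨2 * n + 2, by omega, by simp [parity_simps], ?_⟩
  rcases key n with h | h <;> omega

theorem invAckermann_spec (n : ℕ) :
    0 < invAckermann n ∧ Even (invAckermann n) ∧ lambdaFn (invAckermann n) n ≤ 6 :=
  Nat.sInf_mem (exists_lambdaFn_le_six n)

/-! ### Codes of depth one and two -/

theorem hasCode_one_of_heavy (F : Type u) [Field F] [Fintype F] [DecidableEq F] {n : ℕ} (hn : 1 ≤ n)
    (Z : ℕ) : HasCode F n 1 (32 * n * ((Fintype.card F + 3) * Z)) (4 * n)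
      {x | n ≤ Z * hammingNorm x} :=
  ((hasSampler_of_heavy F hn Z).hasCode_four hn).mono le_rfl (by omega) subset_rfl

theorem hasSampler_one (F : Type u) [Field F] [Fintype F] [DecidableEq F] {n : ℕ} (hn : 1 ≤ n)
    (L : ℕ) : HasSampler F n 1 (16 * (Fintype.card F + 3) * (L + 5) * L * n)
      ((Fintype.card F + 3) * 8 * (L + 1)) {x | n ≤ 2 ^ L * hammingNorm x} := by
  induction L with
  | zero =>
    exact (hasSampler_of_heavy F hn 1).mono (by omega) (by omega) (by omega)
      (fun x hx => by simpa using hx)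
  | succ L ih =>
    -- If `n < 2 ^ L`, every nonzero input already belongs to the class for `L`.
    rcases Nat.lt_or_ge n (2 ^ L) with h | h
    · refine ih.mono le_rfl (by gcongr <;> omega) (by gcongr; omega) fun x hx => ?_
      replace hx : n ≤ 2 ^ (L + 1) * hammingNorm x := hx
      change n ≤ 2 ^ L * hammingNorm x
      have : 1 ≤ hammingNorm x := by
        by_contra h0
        have : hammingNorm x = 0 := by omega
        rw [this] at hx
        omega
      nlinarith
    · refine (ih.union (hasSampler_of_weight_range F L h)).mono le_rfl ?_ ?_ ?_
      · nlinarith [Nat.zero_le (16 * (Fintype.card F + 3) * n)]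
      · nlinarith
      · intro x hx
        replace hx : n ≤ 2 ^ (L + 1) * hammingNorm x := hx
        rw [pow_succ, mul_comm _ 2] at hx
        rcases Nat.le_total n (2 ^ L * hammingNorm x) with h' | h'
        · exact Or.inl h'
        · exact Or.inr ⟨hx, h'⟩

theorem hasCode_two (F : Type u) [Field F] [Fintype F] [DecidableEq F] {n : ℕ} (hn : 1 ≤ n)
    (L : ℕ) : HasCode F n 2 (256 * (Fintype.card F + 3) * (L + 1) ^ 2 * n) (4 * n)
      {x | n ≤ 2 ^ L * hammingNorm x} := by
  refine ((hasSampler_one F hn L).hasCode_four hn).mono le_rfl ?_ subset_rfl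
  have : 16 * (L + 5) * L + 32 * (8 * (L + 1)) ≤ 256 * (L + 1) ^ 2 := by nlinarith
  calc _ = (16 * (L + 5) * L + 32 * (8 * (L + 1))) * ((Fintype.card F + 3) * n) := by ring
    _ ≤ 256 * (L + 1) ^ 2 * ((Fintype.card F + 3) * n) := by gcongr
    _ = _ := by ring

/-! ### Condensing and the recursion on depth -/

/-- Condense `n` inputs to `n / g` gates, and encode these. This handles the inputs of relative
weight between `1 / Z₁` and `1 / Z₂`. -/
theorem hasSampler_of_condense {g Z₁ Z₂ : ℕ} (hn : 1 ≤ n) (hg : 1 ≤ g) (hgZ : g ≤ Z₂)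
    (hZ : 16000000 * g ^ 4 ≤ Z₂ ^ 3)
    (h : 1 ≤ n / g → HasCode F (n / g) d S (4 * (n / g)) {y | n ≤ Z₁ * hammingNorm y}) :
    HasSampler F n (d + 1) (9 * n + S) ((Fintype.card F + 3) * 8)
      {x | n ≤ Z₁ * hammingNorm x ∧ Z₂ * hammingNorm x ≤ n} := by
  rcases Nat.lt_or_ge n Z₂ with hlt | hge
  -- For `n < Z₂` the upper bound forces weight `0` and the lower bound excludes it: the class is
  -- empty.
  · refine (hasSampler_of_heavy F hn 8).mono (by omega) (by omega) le_rfl fun x hx => ?_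
    have : hammingNorm x = 0 := by
      by_contra h0
      have h1 : Z₂ * 1 ≤ Z₂ * hammingNorm x := Nat.mul_le_mul_left _ (by omega)
      have := hx.2
      omega
    have := hx.1
    simp_all
  · set m := n / g with hm
    have hm1 : 1 ≤ m := (Nat.one_le_div_iff (by omega)).2 (hgZ.trans hge)
    set s := n / Z₂ with hs
    have hsZ : s * Z₂ ≤ n := Nat.div_mul_le_self n Z₂
    have hnm : n ≤ 2 * g * m := by
      have := Nat.lt_mul_div_succ n (show 0 < g by omega)
      rw [← hm] at this
      nlinarith
    -- The factor `16` in `16000000` is the fourth power of the `2` lost in rounding `n / g`.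
    have hms : 1000000 * n * s ^ 3 ≤ m ^ 4 := by
      refine Nat.le_of_mul_le_mul_left ?_ (show 0 < 16 * g ^ 4 by positivity)
      calc 16 * g ^ 4 * (1000000 * n * s ^ 3) = 16000000 * g ^ 4 * (n * s ^ 3) := by ring
        _ ≤ Z₂ ^ 3 * (n * s ^ 3) := by gcongr
        _ = n * (s * Z₂) ^ 3 := by ring
        _ ≤ n * n ^ 3 := by gcongr
        _ = n ^ 4 := by ring
        _ ≤ (2 * g * m) ^ 4 := by gcongr
        _ = 16 * g ^ 4 * m ^ 4 := by ring
    obtain ⟨A, hA, hAx⟩ := exists_sparse_condenser F (Nat.div_le_self n Z₂) hm1 hms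
    refine (((h hm1).precomp A hA).hasSampler (by omega)).mono le_rfl le_rfl le_rfl ?_
    intro x hx
    change n ≤ Z₁ * hammingNorm (A.mulVec x)
    refine hx.1.trans (Nat.mul_le_mul_left _ (hAx x ?_))
    rw [Nat.le_div_iff_mul_le (by omega), mul_comm]
    exact hx.2

/-- After condensing, the relative weight is at least about `g / Z₁`. A depth-one code on `n / g`
gates thus costs about `n * Z₁ / g ^ 2 ≤ T * n`, up to a factor depending on `q` and rounding. -/
theorem hasSampler_of_condense_dense {g Z₁ Z₂ T : ℕ} (hn : 1 ≤ n) (hg : 1 ≤ g) (hgZ : g ≤ Z₂)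
    (hZ : 16000000 * g ^ 4 ≤ Z₂ ^ 3) (hT : Z₁ ≤ T * g ^ 2) :
    HasSampler F n 2 (9 * n + 32 * (Fintype.card F + 3) * (T + 1) * n) ((Fintype.card F + 3) * 8)
      {x | n ≤ Z₁ * hammingNorm x ∧ Z₂ * hammingNorm x ≤ n} := by
  refine hasSampler_of_condense hn hg hgZ hZ fun hm => ?_
  set m := n / g with hmdef
  have hmg : m * g ≤ n := Nat.div_mul_le_self n g
  have hmn : m ≤ n := Nat.div_le_self n g
  set Z := m * Z₁ / n + 1 with hZdef
  have h1 : m * Z₁ ≤ Z * n := by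
    have := Nat.lt_mul_div_succ (m * Z₁) (show 0 < n by omega)
    rw [mul_comm Z]
    exact this.le
  have h2 : m * (m * Z₁ / n) ≤ T * n := by
    refine Nat.le_of_mul_le_mul_right ?_ (show 0 < n by omega)
    calc m * (m * Z₁ / n) * n = m * (m * Z₁ / n * n) := by ring
      _ ≤ m * (m * Z₁) := Nat.mul_le_mul_left _ (Nat.div_mul_le_self _ _)
      _ ≤ m * (m * (T * g ^ 2)) := by gcongr
      _ = T * ((m * g) * (m * g)) := by ring
      _ ≤ T * (n * n) := by gcongr
      _ = T * n * n := by ring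
  refine (hasCode_one_of_heavy F hm Z).mono le_rfl ?_ fun y hy => ?_
  · calc 32 * m * ((Fintype.card F + 3) * Z)
        = 32 * (Fintype.card F + 3) * (m * (m * Z₁ / n) + m) := by rw [hZdef]; ring
      _ ≤ 32 * (Fintype.card F + 3) * (T * n + n) := by gcongr
      _ = _ := by ring
  · replace hy : n ≤ Z₁ * hammingNorm y := hy
    change m ≤ Z * hammingNorm y
    refine Nat.le_of_mul_le_mul_right ?_ (show 0 < n by omega)
    calc m * n ≤ m * (Z₁ * hammingNorm y) := by gcongr
      _ = m * Z₁ * hammingNorm y := by ring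
      _ ≤ Z * n * hammingNorm y := by gcongr
      _ = _ := by ring

/-- If one step of `f` costs `B` wires, then all weights can be handled with `B * f^*` wires. -/
theorem hasSampler_iterStar {f : ℕ → ℕ} (hf : ∀ X, 2 ≤ X → 1 ≤ f X ∧ f X < X) {B c : ℕ} (hn : 1 ≤ n)
    (hc : (Fintype.card F + 3) * 4096 ≤ c)
    (hstep : ∀ X, 2 ≤ X → HasSampler F n d B c
      {x | n ≤ 4096 * X ^ 4 * hammingNorm x ∧ 4096 * f X ^ 4 * hammingNorm x ≤ n})
    {X : ℕ} (hX : 1 ≤ X) :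
    HasSampler F n d (B * iterStar f X) (c * (iterStar f X + 1))
      {x | n ≤ 4096 * X ^ 4 * hammingNorm x} := by
  induction X using Nat.strong_induction_on with
  | _ X ih =>
    rcases Nat.lt_or_ge X 2 with h | h
    · obtain rfl : X = 1 := by omega
      rw [iterStar_of_le_one le_rfl]
      exact (hasSampler_of_heavy F hn 4096).mono (by omega) (by omega) (by omega)
        fun x hx => by simpa using hx
    · rw [iterStar_step hf h]
      refine ((hstep X h).union (ih (f X) (hf X h).2 (hf X h).1)).mono le_rfl
        (le_of_eq (by ring)) (le_of_eq (by ring)) fun x hx => ?_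
      rcases Nat.le_total n (4096 * f X ^ 4 * hammingNorm x) with h' | h'
      · exact Or.inr h'
      · exact Or.inl ⟨hx, h'⟩

theorem hasSampler_sqrt_step (hn : 1 ≤ n) {X : ℕ} (hX : 2 ≤ X) :
    HasSampler F n 2 ((72 + 400000 * (Fintype.card F + 3)) * n) ((Fintype.card F + 3) * 4096)
      {x | n ≤ 4096 * X ^ 4 * hammingNorm x ∧ 4096 * Nat.sqrt X ^ 4 * hammingNorm x ≤ n} := by
  set Y := Nat.sqrt X with hY
  have hY1 : 1 ≤ Y := Nat.sqrt_pos.2 (by omega)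
  have hXY : X ≤ 3 * Y ^ 2 := by
    have := Nat.sqrt_le_add X
    rw [← hY] at this
    nlinarith
  -- A single condensation cannot bridge the range at linear cost, so it is cut at `4096 * Y ^ 6`.
  -- From `X ≤ 3 * Y ^ 2` comes `T = 4096 * 81 / 64 = 5184`; the second part has `T = 4096 / 64 =
  -- 64`.
  have h1 := hasSampler_of_condense_dense (F := F) (n := n) (g := 8 * Y ^ 4) (Z₁ := 4096 * X ^ 4)
    (Z₂ := 4096 * Y ^ 6) (T := 5184) hn (by have : 0 < Y ^ 4 := by positivity
                                            omega)
    (by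
      have : Y ^ 4 ≤ Y ^ 6 := Nat.pow_le_pow_right hY1 (by norm_num)
      omega)
    (by
      have : Y ^ 16 ≤ Y ^ 18 := Nat.pow_le_pow_right hY1 (by norm_num)
      ring_nf
      omega)
    (by
      have : X ^ 4 ≤ (3 * Y ^ 2) ^ 4 := Nat.pow_le_pow_left hXY 4
      ring_nf at this ⊢
      omega)
  have h2 := hasSampler_of_condense_dense (F := F) (n := n) (g := 8 * Y ^ 3) (Z₁ := 4096 * Y ^ 6)
    (Z₂ := 4096 * Y ^ 4) (T := 64) hn (by have : 0 < Y ^ 3 := by positivity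
                                          omega)
    (by
      have : Y ^ 3 ≤ Y ^ 4 := Nat.pow_le_pow_right hY1 (by norm_num)
      omega)
    (by
      ring_nf
      omega)
    (by
      ring_nf
      omega)
  refine (h1.union h2).mono le_rfl ?_ (by omega) fun x hx => ?_
  · nlinarith
  · rcases Nat.le_total n (4096 * Y ^ 6 * hammingNorm x) with h' | h'
    · exact Or.inr ⟨h', hx.2⟩
    · exact Or.inl ⟨hx.1, h'⟩

/-- The choice `g = 8 * Y ^ 2`, `Z₂ = 4096 * Y ^ 4` works because `16000000 ≤ 4096 ^ 2`. It leaves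
room for a code whose cost per input is of order `Y ^ 2`. -/
theorem hasSampler_of_condense_sq {X Y : ℕ} (hn : 1 ≤ n) (hY : 1 ≤ Y)
    (h : 1 ≤ n / (8 * Y ^ 2) → HasCode F (n / (8 * Y ^ 2)) d S (4 * (n / (8 * Y ^ 2)))
      {y | n ≤ 4096 * X ^ 4 * hammingNorm y}) :
    HasSampler F n (d + 1) (9 * n + S) ((Fintype.card F + 3) * 8)
      {x | n ≤ 4096 * X ^ 4 * hammingNorm x ∧ 4096 * Y ^ 4 * hammingNorm x ≤ n} := by
  refine hasSampler_of_condense hn ?_ ?_ ?_ h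
  · have : 0 < Y ^ 2 := by positivity
    omega
  · have : Y ^ 2 ≤ Y ^ 4 := Nat.pow_le_pow_right hY (by norm_num)
    omega
  · have : Y ^ 8 ≤ Y ^ 12 := Nat.pow_le_pow_right hY (by norm_num)
    ring_nf
    omega

/-- With `X ≤ 2 ^ Y`, the weights span `12 + 4 * Y` dyadic ranges. The depth-two code costs `O(Y ^
2)` per gate, which the `n / (8 * Y ^ 2)` gates absorb. -/
theorem hasSampler_clog_step (hn : 1 ≤ n) {X : ℕ} (hX : 2 ≤ X) :
    HasSampler F n 3 ((72 + 400000 * (Fintype.card F + 3)) * n) ((Fintype.card F + 3) * 4096)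
      {x | n ≤ 4096 * X ^ 4 * hammingNorm x ∧ 4096 * Nat.clog 2 X ^ 4 * hammingNorm x ≤ n} := by
  set Y := Nat.clog 2 X with hY
  have hY1 : 1 ≤ Y := Nat.clog_pos (by omega) hX
  have hXY : X ≤ 2 ^ Y := Nat.le_pow_clog (by omega) X
  refine (hasSampler_of_condense_sq (d := 2) (S := 10000 * (Fintype.card F + 3) * n) hn hY1
    fun hm => ?_).mono le_rfl (by nlinarith) (by omega) subset_rfl
  set m := n / (8 * Y ^ 2) with hmdef
  have hmY : m * (8 * Y ^ 2) ≤ n := Nat.div_mul_le_self _ _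
  have hmn : m ≤ n := Nat.div_le_self _ _
  refine (hasCode_two F hm (12 + 4 * Y)).mono le_rfl ?_ fun y hy => ?_
  · calc 256 * (Fintype.card F + 3) * (12 + 4 * Y + 1) ^ 2 * m
        ≤ 256 * (Fintype.card F + 3) * (17 * Y) ^ 2 * m := by gcongr; omega
      _ = 9248 * (Fintype.card F + 3) * (m * (8 * Y ^ 2)) := by ring
      _ ≤ 10000 * (Fintype.card F + 3) * n := by gcongr; norm_num
  · replace hy : n ≤ 4096 * X ^ 4 * hammingNorm y := hy
    change m ≤ _
    refine hmn.trans (hy.trans ?_)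
    gcongr
    calc 4096 * X ^ 4 ≤ 4096 * (2 ^ Y) ^ 4 := by gcongr
      _ = 2 ^ (12 + 4 * Y) := by rw [pow_add, ← pow_mul]; ring_nf

/-- The constant is the same for all `e`: the code from two levels below runs on so few gates that
its cost returns below the budget of one step. -/
theorem hasSampler_lambdaFn (F : Type u) [Field F] [Fintype F] [DecidableEq F] (e : ℕ) :
    ∀ {n X : ℕ}, 1 ≤ n → 1 ≤ X →
      HasSampler F n (e + 2) ((72 + 400000 * (Fintype.card F + 3)) * n * lambdaFn (e + 3) X)
        ((Fintype.card F + 3) * 4096 * (lambdaFn (e + 3) X + 1))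
        {x | n ≤ 4096 * X ^ 4 * hammingNorm x} := by
  induction e using Nat.twoStepInduction with
  | zero =>
    intro n X hn hX
    exact hasSampler_iterStar (lambdaFn_pos_and_lt 0) hn le_rfl
      (fun X hX => hasSampler_sqrt_step hn hX) hX
  | one =>
    intro n X hn hX
    exact hasSampler_iterStar (lambdaFn_pos_and_lt 1) hn le_rfl
      (fun X hX => hasSampler_clog_step hn hX) hX
  | more e ih _ =>
    intro n X hn hX
    refine hasSampler_iterStar (lambdaFn_pos_and_lt (e + 2)) hn le_rfl (fun X hX => ?_) hX
    obtain ⟨hY1, -⟩ : 1 ≤ lambdaFn (e + 3) X ∧ _ := lambdaFn_pos_and_lt (e + 2) X hX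
    change HasSampler F n (e + 3 + 1) _ _ {x | n ≤ 4096 * X ^ 4 * hammingNorm x ∧
      4096 * lambdaFn (e + 3) X ^ 4 * hammingNorm x ≤ n}
    set Y := lambdaFn (e + 3) X
    set q := Fintype.card F
    refine (hasSampler_of_condense_sq (d := e + 3) (S := (63 + 400000 * (q + 3)) * n) hn hY1
      fun hm => ?_).mono le_rfl (by nlinarith) (by omega) subset_rfl
    set m := n / (8 * Y ^ 2) with hmdef
    have hmY : m * (8 * Y ^ 2) ≤ n := Nat.div_mul_le_self _ _
    have hmn : m ≤ n := Nat.div_le_self _ _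
    refine ((ih hm (by omega : 1 ≤ X)).hasCode_four hm).mono le_rfl ?_
      fun y hy => hmn.trans hy
    -- Bounding `Y` by `Y * Y` and using `m * (8 * Y ^ 2) ≤ n` divides the inherited constant by
    -- `8`, which makes room for the new output layer.
    calc (72 + 400000 * (q + 3)) * m * Y + 32 * m * ((q + 3) * 4096 * (Y + 1))
        ≤ (72 + 400000 * (q + 3)) * m * (Y * Y) + 32 * m * ((q + 3) * 4096 * (2 * (Y * Y))) := by
          gcongr
          · nlinarith
          · nlinarith
      _ = (9 + 82768 * (q + 3)) * (m * (8 * Y ^ 2)) := by ring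
      _ ≤ (63 + 400000 * (q + 3)) * n := by gcongr <;> norm_num

/-! ### Assembly -/

theorem hasCode_lambdaFn (F : Type u) [Field F] [Fintype F] [DecidableEq F] (e : ℕ) {n : ℕ}
    (hn : 1 ≤ n) :
    HasCode F n (e + 3) ((72 + 600000 * (Fintype.card F + 3)) * n * (lambdaFn (e + 3) n + 1)) (4 * n)
      {x | x ≠ 0} := by
  refine ((hasSampler_lambdaFn F e hn hn).hasCode_four hn).mono le_rfl ?_ fun x hx => ?_
  · nlinarith [Nat.zero_le (n * lambdaFn (e + 3) n), Nat.zero_le n,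
      Nat.zero_le (Fintype.card F * n * lambdaFn (e + 3) n), Nat.zero_le (Fintype.card F * n)]
  · have h1 : 0 < hammingNorm x := hammingNorm_pos_iff.2 hx
    change n ≤ _
    calc n = 1 * n ^ 1 * 1 := by ring
      _ ≤ 4096 * n ^ 4 * hammingNorm x := by
          gcongr
          · norm_num
          · norm_num
          · exact h1

theorem hasCode_one (F : Type u) [Field F] [Fintype F] [DecidableEq F] {n : ℕ} (hn : 1 ≤ n) :
    HasCode F n 1 (32 * (Fintype.card F + 3) * n * n) (4 * n) {x | x ≠ 0} :=
  (hasCode_one_of_heavy F hn n).mono le_rfl (le_of_eq (by ring)) fun x hx =>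
    Nat.le_mul_of_pos_right n (hammingNorm_pos_iff.2 hx)

omit [Fintype F] in
theorem HasCode.exists_linearCircuit (h : HasCode F n d S (4 * n) {x | x ≠ 0}) :
    ∃ (C : (Fin n → F) →ₗ[F] (Fin (32 * n) → F)) (c : LinearCircuit F n (32 * n)),
      MinDistGE C (4 * n) ∧ c.Computes C ∧ c.DepthLE d ∧ c.size ≤ S := by
  obtain ⟨C, out, hout, hd, hS, hP⟩ := h
  let e : Fin (32 * n) ≃ Fin (8 * (4 * n)) := finCongr (by ring)
  obtain ⟨L, c, hL, h1, h2, h3⟩ := C.exists_linearCircuit hd (out ∘ e) (hout.comp e.injective)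
  refine ⟨L, c, fun x y hxy => ?_, h1, h2, h3.trans_le hS⟩
  have hne : -x + y ≠ 0 := fun h0 => hxy (neg_add_eq_zero.1 h0)
  rw [hammingDist_eq_hammingNorm, ← map_neg, ← map_add, hL]
  refine (hP (-x + y) hne).trans (le_of_eq ?_)
  unfold hammingNorm
  rw [Finset.card_filter, Finset.card_filter, ← e.sum_comp]
  rfl

end Samplers

theorem mainTheorem2 (F : Type*) [Field F] [Fintype F] [DecidableEq F] :
    ∃ K : ℕ,
      (∀ d n : ℕ, 1 ≤ d → 1 ≤ n →
        ∃ (C : (Fin n → F) →ₗ[F] (Fin (32 * n) → F)) (c : LinearCircuit F n (32 * n)),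
          MinDistGE C (4 * n) ∧ c.Computes C ∧ c.DepthLE d ∧
            (3 ≤ d → 2 ≤ n → c.size ≤ K * (lambdaFn d n * n))) ∧
      (∀ n : ℕ, 1 ≤ n →
        ∃ (C : (Fin n → F) →ₗ[F] (Fin (32 * n) → F)) (c : LinearCircuit F n (32 * n)),
          MinDistGE C (4 * n) ∧ c.Computes C ∧ c.DepthLE (invAckermann n) ∧
            c.size ≤ K * n) := by
  set q := Fintype.card F with hq
  -- The factor `7` serves twice: `λ + 1 ≤ 7 * λ` when `λ ≥ 1`, and `λ + 1 ≤ 7` at the inverse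
  -- Ackermann depth.
  refine ⟨(72 + 600000 * (q + 3)) * 7, fun d n hd hn => ?_, fun n hn => ?_⟩
  · rcases Nat.lt_or_ge d 3 with hd3 | hd3
    · obtain ⟨C, c, h1, h2, h3, -⟩ :=
        ((hasCode_one F hn).mono hd le_rfl subset_rfl).exists_linearCircuit
      exact ⟨C, c, h1, h2, h3, fun h => absurd hd3 (not_lt.2 h)⟩
    · obtain ⟨e, rfl⟩ := Nat.exists_eq_add_of_le' hd3
      obtain ⟨C, c, h1, h2, h3, h4⟩ := (hasCode_lambdaFn F e hn).exists_linearCircuit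
      refine ⟨C, c, h1, h2, h3, fun _ hn2 => h4.trans ?_⟩
      have hl : 1 ≤ lambdaFn (e + 3) n := (lambdaFn_pos_and_lt (e + 2) n hn2).1
      calc (72 + 600000 * (q + 3)) * n * (lambdaFn (e + 3) n + 1)
          ≤ (72 + 600000 * (q + 3)) * n * (7 * lambdaFn (e + 3) n) := by gcongr; omega
        _ = _ := by ring
  · obtain ⟨hpos, heven, h6⟩ := invAckermann_spec n
    rcases Nat.lt_or_ge (invAckermann n) 3 with hd3 | hd3
    · have h2 : invAckermann n = 2 := by
        obtain ⟨r, hr⟩ := heven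
        omega
      rw [h2] at h6 ⊢
      -- Here `⌈log₂ n⌉ ≤ 6`, so `n` is bounded and the quadratic depth-one circuit has linear size.
      have hn64 : n ≤ 2 ^ 6 := (Nat.clog_le_iff_le_pow (by norm_num)).1 h6
      refine ((hasCode_one F hn).mono (by norm_num) ?_ subset_rfl).exists_linearCircuit
      calc 32 * (q + 3) * n * n ≤ 32 * (q + 3) * 2 ^ 6 * n := by gcongr
        _ = 2048 * (q + 3) * n := by ring
        _ ≤ _ := by
          exact Nat.mul_le_mul_right _ (by omega)
    · obtain ⟨e, he⟩ := Nat.exists_eq_add_of_le' hd3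
      rw [he] at h6 ⊢
      refine ((hasCode_lambdaFn F e hn).mono le_rfl ?_ subset_rfl).exists_linearCircuit
      calc (72 + 600000 * (q + 3)) * n * (lambdaFn (e + 3) n + 1)
          ≤ (72 + 600000 * (q + 3)) * n * (6 + 1) := by gcongr
        _ = _ := by ring
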